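/- For $x,q,r\in\mathbb C$ with $|q|,|r|<1$ let $(x;q,r)=\prod_{j,k=0}^\infty(1-xq^jr^k)$, and extend this symbol to all $q,r\neq 0$ with $|q|\ne1\ne|r|$ by the rules $(x;q^{-1},r)=1/(qx;q,r)$ and $(x;q,r^{-1})=1/(rx;q,r)$. For $\tau,\sigma\in\mathbb C\setminus\mathbb R$ the elliptic gamma function is the meromorphic function of $z\in\mathbb C$ $$\Gamma(z,\tau,\sigma)=\frac{(qr/x;q,r)}{(x;q,r)},\qquad x=e^{2\pi iz},\ q=e^{2\pi i\tau},\ r=e^{2\pi i\sigma}.$$ **Theorem (modular three-term relations).** Suppose that $\tau,\sigma,\sigma/\tau,\tau+\sigma\in\mathbb C\setminus\mathbb R$. Let $$Q(z;\tau,\sigma)=\frac{z^3}{3\tau\sigma}-\frac{\tau+\sigma-1}{2\tau\sigma}z^2+\frac{\tau^2+\sigma^2+3\tau\sigma-3\tau-3\sigma+1}{6\tau\sigma}z+\frac1{12}(\tau+\sigma-1)(\tau^{-1}+\sigma^{-1}-1).$$ Then $$\Gamma(z,\tau+1,\sigma)=\Gamma(z,\tau,\sigma+1)=\Gamma(z,\tau,\sigma),$$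 $$\Gamma(z,\tau+\sigma,\sigma)=\frac{\Gamma(z,\tau,\sigma)}{\Gamma(z+\tau,\tau,\sigma+\tau)},$$ $$\Gamma\Big(\frac z\sigma,\frac\tau\sigma,-\frac1\sigma\Big)=e^{i\pi Q(z;\tau,\sigma)}\,\Gamma\Big(\frac{z-\sigma}\tau,-\frac1\tau,-\frac\sigma\tau\Big)\,\Gamma(z,\tau,\sigma),$$ $$\Gamma\Big(\frac z\tau,-\frac1\tau,\frac\sigma\tau\Big)=e^{i\pi Q(z;\tau,\sigma)}\,\Gamma\Big(\frac{z-\tau}\sigma,-\frac\tau\sigma,-\frac1\sigma\Big)\,\Gamma(z,\tau,\sigma).$$ These are identities of meromorphic functions of $z\in\mathbb C$. They also hold between values at every $z$ at which the gamma functions on the right-hand side have no pole (and, in the second identity, the denominator does not vanish). -/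

import Mathlib

open Filter

noncomputable section

namespace EllipticGamma

/-- The double infinite product `∏_{j,k ≥ 0} (1 - x q^j r^k)`, used for `‖q‖ < 1` and `‖r‖ < 1`
(where it converges absolutely for every `x`). -/
def doubleProd (x q r : ℂ) : ℂ :=
  ∏' p : ℕ × ℕ, (1 - x * q ^ p.1 * r ^ p.2)

open Classical in
/-- The symbol `(x; q, r)` for nonzero `q`, `r` with `‖q‖ ≠ 1` and `‖r‖ ≠ 1`: the double product
when `‖q‖, ‖r‖ < 1`, extended by the rules
`(x; q⁻¹, r) = 1 / (q x; q, r)` and `(x; q, r⁻¹) = 1 / (r x; q, r)`.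
(When both rules are used, the two inversions cancel.) -/
def symb (x q r : ℂ) : ℂ :=
  if ‖q‖ < 1 then
    if ‖r‖ < 1 then doubleProd x q r
    else (doubleProd (r⁻¹ * x) q r⁻¹)⁻¹
  else
    if ‖r‖ < 1 then (doubleProd (q⁻¹ * x) q⁻¹ r)⁻¹
    else doubleProd (q⁻¹ * r⁻¹ * x) q⁻¹ r⁻¹

/-- `e(z) = exp (2πiz)`. -/
def e (z : ℂ) : ℂ := Complex.exp (2 * Real.pi * Complex.I * z)

/-- The elliptic gamma function `Γ(z, τ, σ) = (qr/x; q, r) / (x; q, r)`, with `x = e(z)`,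
`q = e(τ)`, `r = e(σ)`, for non-real `τ`, `σ`.  At a pole in `z` the value is `0` by the
convention for division by zero. -/
def Gam (z τ σ : ℂ) : ℂ :=
  symb (e τ * e σ / e z) (e τ) (e σ) / symb (e z) (e τ) (e σ)

/-- `z` is a pole of the function `Γ(·, τ, σ)`. -/
def IsPole (z τ σ : ℂ) : Prop :=
  meromorphicOrderAt (fun w => Gam w τ σ) z < 0

/-- `f` and `g` are meromorphic on `ℂ` and equal as meromorphic functions, that is, their values
agree off a closed discrete set. -/
def MeroEq (f g : ℂ → ℂ) : Prop :=
  Meromorphic f ∧ Meromorphic g ∧ f =ᶠ[codiscrete ℂ] g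

/-- The polynomial `Q(z; τ, σ)`, cubic in `z`. -/
def Q (z τ σ : ℂ) : ℂ :=
  z ^ 3 / (3 * τ * σ)
    - (τ + σ - 1) / (2 * τ * σ) * z ^ 2
    + (τ ^ 2 + σ ^ 2 + 3 * τ * σ - 3 * τ - 3 * σ + 1) / (6 * τ * σ) * z
    + 1 / 12 * (τ + σ - 1) * (τ⁻¹ + σ⁻¹ - 1)

end EllipticGamma

end

namespace EllipticGamma

/-! ### Double infinite products -/

/-! Both modular relations are one homogeneous statement. For a, b, c with pairwise non-real ratios
let F(z) = Γ(z/c; a/c, b/c) Γ(z/a; b/a, c/a) Γ(z/b; c/b, a/b) exp(iπ B₃₃(z|a,b,c)/3). Then F = 1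
(`normTripleGam_eq_one`). Taking (a, b, c) = (1, τ, σ) at the point z + 1 gives the third relation,
and exchanging τ and σ gives the fourth.

The shift z ↦ z + a fixes the middle gamma factor, multiplies each of the other two by a theta
function, and multiplies the exponential by exp(iπ B₂₂(z|b,c)). The product of these multipliers is
a cube root of unity: this is the modular transformation of theta (`exists_theta_mul_theta`), where
Liouville gives a constant c and the duplication formula gives c⁴ = c. By cyclic symmetry F³ has
periods a and b. Since F is holomorphic on a hexagon whose translates cover the plane
(`exists_add_mem_hexagon`), F³ is constant. At the centre (a + b + c)/2 all three gamma values are 1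
and B₃₃ vanishes, which fixes F³ and, by continuity, F.

The additive relation comes from cutting the index quadrant along its diagonal (`doubleProd_add`)
when the imaginary parts are positive; reflections of the parameters reduce the other sign patterns
to this one.

These identities are first obtained off a countable set. They pass to values because Γ is a quotient
of entire functions without common zeros (`exists_isRep`). -/

theorem tprod_eq_mul_of_isCompl_range {α β γ : Type*} {f : α → ℂ} {i : β → α} {j : γ → α}
    (hi : i.Injective) (hj : j.Injective) (h : IsCompl (Set.range i) (Set.range j))
    (hfi : Multipliable (f ∘ i)) (hfj : Multipliable (f ∘ j)) :
    ∏' a, f a = (∏' b, f (i b)) * ∏' c, f (j c) :=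
  (HasProd.mul_isCompl h (hi.hasProd_range_iff.2 hfi.hasProd)
    (hj.hasProd_range_iff.2 hfj.hasProd)).tprod_eq

theorem summable_norm_mul_pow_mul_pow {q r : ℂ} (hq : ‖q‖ < 1) (hr : ‖r‖ < 1) (x : ℂ) :
    Summable fun p : ℕ × ℕ => ‖x * q ^ p.1 * r ^ p.2‖ := by
  have h := (summable_geometric_of_lt_one (norm_nonneg q) hq).mul_of_nonneg
    (summable_geometric_of_lt_one (norm_nonneg r) hr) (fun _ => by positivity)
    (fun _ => by positivity)
  refine (h.mul_left ‖x‖).congr fun p => ?_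
  simp [mul_assoc]

theorem multipliable_doubleProd {q r : ℂ} (hq : ‖q‖ < 1) (hr : ‖r‖ < 1) (x : ℂ) :
    Multipliable fun p : ℕ × ℕ => 1 - x * q ^ p.1 * r ^ p.2 := by
  simp_rw [sub_eq_add_neg]
  exact multipliable_one_add_of_summable
    (by simpa using summable_norm_mul_pow_mul_pow hq hr x)

theorem differentiable_doubleProd {q r : ℂ} (hq : ‖q‖ < 1) (hr : ‖r‖ < 1) :
    Differentiable ℂ fun x => doubleProd x q r := by
  intro x
  have h : HasProdLocallyUniformlyOn
      (fun (p : ℕ × ℕ) (x : ℂ) => 1 + -(x * q ^ p.1 * r ^ p.2))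
      (fun x => ∏' p : ℕ × ℕ, (1 + -(x * q ^ p.1 * r ^ p.2)))
      (Metric.ball (0 : ℂ) (‖x‖ + 1)) := by
    refine Summable.hasProdLocallyUniformlyOn_one_add Metric.isOpen_ball
      (summable_norm_mul_pow_mul_pow hq hr ((‖x‖ + 1 : ℝ) : ℂ))
      (.of_forall fun p y hy => ?_) fun p => by fun_prop
    rw [mem_ball_zero_iff] at hy
    have h0 : 0 ≤ ‖x‖ + 1 := by positivity
    simp only [norm_neg, norm_mul, Complex.norm_real, Real.norm_of_nonneg h0]
    gcongr
  have hd := h.differentiableOn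
    (.of_forall fun _ => by
      simpa [Finset.prod_fn] using DifferentiableOn.finsetProd (fun _ _ => by fun_prop))
    Metric.isOpen_ball
  have := hd.differentiableAt (x := x) (Metric.isOpen_ball.mem_nhds (by simp))
  simpa only [doubleProd, sub_eq_add_neg] using this

theorem doubleProd_ne_zero {q r x : ℂ} (hq : ‖q‖ < 1) (hr : ‖r‖ < 1)
    (hx : ∀ j k : ℕ, x * q ^ j * r ^ k ≠ 1) : doubleProd x q r ≠ 0 := by
  simp_rw [doubleProd, sub_eq_add_neg]
  refine tprod_one_add_ne_zero_of_summable (fun p h => hx p.1 p.2 ?_)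
    (by simpa using summable_norm_mul_pow_mul_pow hq hr x)
  linear_combination -h

theorem doubleProd_ne_zero_of_norm_lt_one {q r x : ℂ} (hq : ‖q‖ < 1) (hr : ‖r‖ < 1)
    (hx : ‖x‖ < 1) : doubleProd x q r ≠ 0 := by
  refine doubleProd_ne_zero hq hr fun j k h => ?_
  have h1 : ‖x * q ^ j * r ^ k‖ < 1 := by
    rw [norm_mul, norm_mul, norm_pow, norm_pow, mul_assoc]
    exact mul_lt_one_of_nonneg_of_lt_one_left (norm_nonneg _) hx
      (mul_le_one₀ (pow_le_one₀ (norm_nonneg _) hq.le) (by positivity)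
        (pow_le_one₀ (norm_nonneg _) hr.le))
  rw [h, norm_one] at h1
  exact lt_irrefl _ h1

theorem doubleProd_comm (x q r : ℂ) : doubleProd x q r = doubleProd x r q := by
  rw [doubleProd, ← (Equiv.prodComm ℕ ℕ).tprod_eq]
  exact tprod_congr fun p => by simp; ring

/-- Since 0 ^ 0 = 1, only the row j = 0 survives at q = 0. The simple product (x; r) is therefore
encoded throughout as the case q = 0 of the double one. -/
theorem doubleProd_zero_left (x r : ℂ) : doubleProd x 0 r = ∏' k : ℕ, (1 - x * r ^ k) := by
  have hi : Function.Injective fun k : ℕ => ((0, k) : ℕ × ℕ) := fun a b h => by simpa using h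
  rw [doubleProd, ← hi.tprod_eq]
  · simp
  · rintro ⟨j, k⟩ h
    rcases Nat.eq_zero_or_pos j with rfl | hj
    · exact ⟨k, rfl⟩
    · simp [hj.ne'] at h

theorem multipliable_one_sub_mul_pow {r : ℂ} (hr : ‖r‖ < 1) (x : ℂ) :
    Multipliable fun k : ℕ => 1 - x * r ^ k := by
  simp_rw [sub_eq_add_neg]
  refine multipliable_one_add_of_summable ?_
  simpa using (summable_geometric_of_lt_one (norm_nonneg r) hr).mul_left ‖x‖

theorem doubleProd_eq_mul_left {q r : ℂ} (hq : ‖q‖ < 1) (hr : ‖r‖ < 1) (x : ℂ) :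
    doubleProd x q r = doubleProd x 0 r * doubleProd (q * x) q r := by
  rw [doubleProd_zero_left, doubleProd, doubleProd,
    tprod_eq_mul_of_isCompl_range (i := fun k : ℕ => ((0, k) : ℕ × ℕ))
      (j := fun p : ℕ × ℕ => ((p.1 + 1, p.2) : ℕ × ℕ))]
  · congr 1
    · simp
    · exact tprod_congr fun p => by ring
  · exact fun a b h => by simpa using h
  · rintro ⟨a, b⟩ ⟨c, d⟩ h; simpa using h
  · constructor
    · rw [Set.disjoint_left]
      rintro _ ⟨k, rfl⟩ ⟨p, hp⟩
      simp at hp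
    · rw [codisjoint_iff_le_sup]
      rintro ⟨j, k⟩ -
      rcases j with _ | j
      · exact Or.inl ⟨k, rfl⟩
      · exact Or.inr ⟨(j, k), rfl⟩
  · simpa [Function.comp_def] using multipliable_one_sub_mul_pow hr x
  · refine (multipliable_doubleProd hq hr (q * x)).congr fun p => ?_
    simp only [Function.comp]; ring

/-- The quadrant is cut into k ≥ j and j > k. On the first part q^j r^(j+k) = (qr)^j r^k, on the
second q^(1+j+k) r^k = q · q^j (qr)^k. -/
theorem doubleProd_add {q r : ℂ} (hq : ‖q‖ < 1) (hr : ‖r‖ < 1) (x : ℂ) :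
    doubleProd x q r = doubleProd x (q * r) r * doubleProd (q * x) q (q * r) := by
  have hqr : ‖q * r‖ < 1 := by
    rw [norm_mul]; exact mul_lt_one_of_nonneg_of_lt_one_left (norm_nonneg _) hq hr.le
  rw [doubleProd, doubleProd, doubleProd,
    tprod_eq_mul_of_isCompl_range (i := fun p : ℕ × ℕ => ((p.1, p.1 + p.2) : ℕ × ℕ))
      (j := fun p : ℕ × ℕ => ((1 + p.1 + p.2, p.2) : ℕ × ℕ))]
  · congr 1
    · exact tprod_congr fun p => by ring
    · exact tprod_congr fun p => by ring
  · rintro ⟨a, b⟩ ⟨c, d⟩ h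
    simp only [Prod.mk.injEq] at h ⊢; omega
  · rintro ⟨a, b⟩ ⟨c, d⟩ h
    simp only [Prod.mk.injEq] at h ⊢; omega
  · constructor
    · rw [Set.disjoint_left]
      rintro _ ⟨k, rfl⟩ ⟨p, hp⟩
      simp only [Prod.mk.injEq] at hp
      omega
    · rw [codisjoint_iff_le_sup]
      rintro ⟨j, k⟩ -
      rcases le_or_gt j k with h | h
      · exact Or.inl ⟨(j, k - j), Prod.ext rfl (by dsimp only; omega)⟩
      · exact Or.inr ⟨(j - k - 1, k), Prod.ext (by dsimp only; omega) rfl⟩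
  · refine (multipliable_doubleProd hqr hr x).congr fun p => ?_
    simp only [Function.comp]; ring
  · refine (multipliable_doubleProd hq hqr (q * x)).congr fun p => ?_
    simp only [Function.comp]; ring

theorem doubleProd_zero_eq_one_sub_mul {r : ℂ} (hr : ‖r‖ < 1) (x : ℂ) :
    doubleProd x 0 r = (1 - x) * doubleProd (r * x) 0 r := by
  have h : doubleProd x 0 0 = 1 - x := by
    rw [doubleProd_zero_left, tprod_eq_mulSingle 0]
    · simp
    · intro k hk; simp [hk]
  rw [doubleProd_comm x 0 r, doubleProd_eq_mul_left hr (by simp) x, h,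
    doubleProd_comm (r * x) 0 r]

/-- Even and odd exponents give (x; s²)(sx; s²) = (x; s), and (1 - xs^k)(1 + xs^k) = 1 - x²s^(2k)
gives (x; s)(-x; s) = (x²; s²). -/
theorem doubleProd_zero_duplication {s : ℂ} (hs : ‖s‖ < 1) (x : ℂ) :
    doubleProd x 0 (s ^ 2) * doubleProd (-x) 0 (s ^ 2) *
      (doubleProd (s * x) 0 (s ^ 2) * doubleProd (-(s * x)) 0 (s ^ 2)) =
      doubleProd (x ^ 2) 0 (s ^ 2) := by
  have hs2 : ‖s ^ 2‖ < 1 := by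
    rw [norm_pow]; exact pow_lt_one₀ (norm_nonneg _) hs two_ne_zero
  have heo : ∀ x : ℂ, doubleProd x 0 (s ^ 2) * doubleProd (s * x) 0 (s ^ 2) =
      doubleProd x 0 s := by
    intro x
    simp_rw [doubleProd_zero_left]
    rw [← tprod_even_mul_odd (f := fun k : ℕ => 1 - x * s ^ k)]
    · congr 1
      · exact tprod_congr fun k => by ring
      · exact tprod_congr fun k => by ring
    · exact (multipliable_one_sub_mul_pow hs2 x).congr fun k => by ring
    · exact (multipliable_one_sub_mul_pow hs2 (s * x)).congr fun k => by ring
  have hsq : doubleProd x 0 s * doubleProd (-x) 0 s = doubleProd (x ^ 2) 0 (s ^ 2) := by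
    simp_rw [doubleProd_zero_left]
    rw [← (multipliable_one_sub_mul_pow hs x).tprod_mul (multipliable_one_sub_mul_pow hs (-x))]
    exact tprod_congr fun k => by ring
  rw [← hsq, ← heo x, ← heo (-x), mul_neg]
  ring

/-! ### The exponential `e` -/

theorem e_ne_zero (z : ℂ) : e z ≠ 0 := Complex.exp_ne_zero _

theorem e_add (z w : ℂ) : e (z + w) = e z * e w := by
  rw [e, e, e, ← Complex.exp_add]; ring_nf

theorem e_neg (z : ℂ) : e (-z) = (e z)⁻¹ := by
  rw [e, e, ← Complex.exp_neg]; ring_nf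

theorem e_sub (z w : ℂ) : e (z - w) = e z / e w := by
  rw [sub_eq_add_neg, e_add, e_neg, div_eq_mul_inv]

theorem e_eq_one_iff {z : ℂ} : e z = 1 ↔ ∃ n : ℤ, z = n := by
  have hpi : (2 * Real.pi * Complex.I : ℂ) ≠ 0 := by simp [Real.pi_ne_zero]
  rw [e, Complex.exp_eq_one_iff]
  refine exists_congr fun n => ?_
  rw [mul_comm (n : ℂ)]
  exact mul_right_inj' hpi

theorem e_one : e 1 = 1 := e_eq_one_iff.2 ⟨1, by simp⟩

theorem e_zero : e 0 = 1 := e_eq_one_iff.2 ⟨0, by simp⟩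

theorem e_add_one (z : ℂ) : e (z + 1) = e z := by rw [e_add, e_one, mul_one]

theorem e_nat_mul (n : ℕ) (z : ℂ) : e (n * z) = e z ^ n := by
  rw [e, e, ← Complex.exp_nat_mul]; ring_nf

theorem norm_e (z : ℂ) : ‖e z‖ = Real.exp (-(2 * Real.pi * z.im)) := by
  rw [e, Complex.norm_exp]; simp

theorem norm_e_lt_one_iff {z : ℂ} : ‖e z‖ < 1 ↔ 0 < z.im := by
  rw [norm_e, Real.exp_lt_one_iff, neg_lt_zero, mul_pos_iff_of_pos_left Real.two_pi_pos]

theorem norm_e_ne_one {z : ℂ} (hz : z.im ≠ 0) : ‖e z‖ ≠ 1 := by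
  rw [norm_e, Ne, Real.exp_eq_one_iff]
  simp [Real.pi_ne_zero, hz]

theorem differentiable_e : Differentiable ℂ e := by
  unfold e; fun_prop

/-- Induction on the signs of the imaginary parts of two non-real numbers. -/
theorem im_sign_induction {p : ℂ → ℂ → Prop} (hpos : ∀ τ σ : ℂ, 0 < τ.im → 0 < σ.im → p τ σ)
    (hleft : ∀ τ σ : ℂ, τ.im ≠ 0 → σ.im ≠ 0 → p τ σ → p (-τ) σ)
    (hright : ∀ τ σ : ℂ, τ.im ≠ 0 → σ.im ≠ 0 → p τ σ → p τ (-σ))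
    {τ σ : ℂ} (hτ : τ.im ≠ 0) (hσ : σ.im ≠ 0) : p τ σ := by
  have h1 : ∀ τ σ : ℂ, 0 < τ.im → σ.im ≠ 0 → p τ σ := by
    intro τ σ hτ hσ
    rcases hσ.lt_or_gt with h | h
    · rw [← neg_neg σ]
      exact hright _ _ hτ.ne' (by simpa using hσ) (hpos _ _ hτ (by simpa using h))
    · exact hpos _ _ hτ h
  rcases hτ.lt_or_gt with h | h
  · rw [← neg_neg τ]
    exact hleft _ _ (by simpa using hτ) hσ (h1 _ _ (by simpa using h) hσ)
  · exact h1 _ _ h hσ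

/-! ### The lattice of integral combinations of three complex numbers -/

/-- The set `ℤa + ℤb + ℤc`. -/
def lat (a b c : ℂ) : Set ℂ := {z | ∃ l m n : ℤ, z = l * a + m * b + n * c}

/-- The group can be dense in ℂ, so discreteness is not available. Countability still makes the
complement dense, which suffices for every continuation argument below. -/
theorem countable_lat (a b c : ℂ) : (lat a b c).Countable := by
  refine (Set.countable_range fun p : ℤ × ℤ × ℤ => (p.1 * a + p.2.1 * b + p.2.2 * c : ℂ)).mono ?_
  rintro z ⟨l, m, n, rfl⟩
  exact ⟨(l, m, n), rfl⟩

theorem dense_compl_lat (a b c : ℂ) : Dense (lat a b c)ᶜ :=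
  (countable_lat a b c).dense_compl ℂ

theorem lat_swap (a b c : ℂ) : lat a c b = lat a b c := by
  ext z
  exact ⟨fun ⟨l, m, n, h⟩ => ⟨l, n, m, by rw [h]; ring⟩,
    fun ⟨l, m, n, h⟩ => ⟨l, n, m, by rw [h]; ring⟩⟩

theorem lat_rotate (a b c : ℂ) : lat b c a = lat a b c := by
  ext z
  exact ⟨fun ⟨l, m, n, h⟩ => ⟨n, l, m, by rw [h]; ring⟩,
    fun ⟨l, m, n, h⟩ => ⟨m, n, l, by rw [h]; ring⟩⟩

theorem lat_neg (a b c : ℂ) : lat a (-b) c = lat a b c := by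
  ext z
  exact ⟨fun ⟨l, m, n, h⟩ => ⟨l, -m, n, by rw [h]; push_cast; ring⟩,
    fun ⟨l, m, n, h⟩ => ⟨l, -m, n, by rw [h]; push_cast; ring⟩⟩

theorem add_mem_lat_iff (a b c z : ℂ) (l m n : ℤ) :
    z + (l * a + m * b + n * c) ∈ lat a b c ↔ z ∈ lat a b c := by
  constructor
  · rintro ⟨l', m', n', h⟩
    exact ⟨l' - l, m' - m, n' - n, by push_cast; linear_combination h⟩
  · rintro ⟨l', m', n', h⟩
    exact ⟨l' + l, m' + m, n' + n, by push_cast; linear_combination h⟩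

theorem add_left_mem_lat_iff (a b c z : ℂ) : z + a ∈ lat a b c ↔ z ∈ lat a b c := by
  simpa using add_mem_lat_iff a b c z 1 0 0

theorem add_mid_mem_lat_iff (a b c z : ℂ) : z + b ∈ lat a b c ↔ z ∈ lat a b c := by
  simpa using add_mem_lat_iff a b c z 0 1 0

theorem add_right_mem_lat_iff (a b c z : ℂ) : z + c ∈ lat a b c ↔ z ∈ lat a b c := by
  simpa using add_mem_lat_iff a b c z 0 0 1

theorem neg_mem_lat_iff (a b c z : ℂ) : -z ∈ lat a b c ↔ z ∈ lat a b c := by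
  constructor
  · rintro ⟨l, m, n, h⟩
    exact ⟨-l, -m, -n, by push_cast; linear_combination -h⟩
  · rintro ⟨l, m, n, h⟩
    exact ⟨-l, -m, -n, by push_cast; linear_combination -h⟩

theorem div_mem_lat_iff {d : ℂ} (hd : d ≠ 0) (a b c z : ℂ) :
    z / d ∈ lat (a / d) (b / d) (c / d) ↔ z ∈ lat a b c := by
  refine exists_congr fun l => exists_congr fun m => exists_congr fun n => ?_
  rw [← mul_div_assoc, ← mul_div_assoc, ← mul_div_assoc, ← add_div, ← add_div,
    div_left_inj' hd]

/-! ### The symbol `(x; q, r)` -/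

theorem norm_inv_lt_one_iff {q : ℂ} (h0 : q ≠ 0) (hq : ‖q‖ ≠ 1) : ‖q⁻¹‖ < 1 ↔ ¬ ‖q‖ < 1 := by
  rw [norm_inv, inv_lt_one₀ (norm_pos_iff.2 h0), not_lt]
  exact ⟨le_of_lt, fun h => lt_of_le_of_ne h hq.symm⟩

theorem symb_comm (x q r : ℂ) : symb x q r = symb x r q := by
  unfold symb
  split_ifs
  · exact doubleProd_comm _ _ _
  · rw [doubleProd_comm]
  · rw [doubleProd_comm]
  · rw [doubleProd_comm, mul_comm q⁻¹]

theorem symb_inv_right (x q : ℂ) {r : ℂ} (h0 : r ≠ 0) (hr : ‖r‖ ≠ 1) :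
    symb x q r⁻¹ = (symb (r * x) q r)⁻¹ := by
  unfold symb
  simp only [norm_inv_lt_one_iff h0 hr]
  split_ifs <;> simp [h0, mul_assoc]

theorem symb_inv_left (x : ℂ) {q : ℂ} (r : ℂ) (h0 : q ≠ 0) (hq : ‖q‖ ≠ 1) :
    symb x q⁻¹ r = (symb (q * x) q r)⁻¹ := by
  rw [symb_comm, symb_inv_right x r h0 hq, symb_comm]

theorem symb_of_norm_lt_one (x : ℂ) {q r : ℂ} (hq : ‖q‖ < 1) (hr : ‖r‖ < 1) :
    symb x q r = doubleProd x q r := by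
  rw [symb, if_pos hq, if_pos hr]

/-- For positive imaginary parts this separates the row j = 0, and inverting a base carries it to
the other signs. Off the lattice no factor vanishes, so the divisions hidden in the extended symbol
are genuine. -/
theorem symb_split {τ σ : ℂ} (hτ : τ.im ≠ 0) (hσ : σ.im ≠ 0) : ∀ z ∉ lat 1 τ σ,
    symb (e z) (e τ) (e σ) ≠ 0 ∧ symb (e z) 0 (e σ) ≠ 0 ∧
      symb (e z) (e τ) (e σ) = symb (e z) 0 (e σ) * symb (e (z + τ)) (e τ) (e σ) := by
  refine im_sign_induction (p := fun τ σ => ∀ z ∉ lat 1 τ σ,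
    symb (e z) (e τ) (e σ) ≠ 0 ∧ symb (e z) 0 (e σ) ≠ 0 ∧
      symb (e z) (e τ) (e σ) = symb (e z) 0 (e σ) * symb (e (z + τ)) (e τ) (e σ))
    ?_ ?_ ?_ hτ hσ
  · intro τ σ hτ hσ z hz
    rw [← norm_e_lt_one_iff] at hτ hσ
    have h0 : ‖(0 : ℂ)‖ < 1 := by simp
    rw [symb_of_norm_lt_one _ hτ hσ, symb_of_norm_lt_one _ hτ hσ, symb_of_norm_lt_one _ h0 hσ,
      doubleProd_eq_mul_left hτ hσ, e_add, mul_comm (e z)]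
    have hmem : ∀ j k : ℕ, e z * e τ ^ j * e σ ^ k ≠ 1 := by
      intro j k h
      rw [← e_nat_mul, ← e_nat_mul, ← e_add, ← e_add, e_eq_one_iff] at h
      obtain ⟨n, hn⟩ := h
      exact hz ⟨n, -j, -k, by push_cast; linear_combination hn⟩
    have h1 : doubleProd (e z) (e τ) (e σ) ≠ 0 := doubleProd_ne_zero hτ hσ hmem
    have h2 : doubleProd (e z) 0 (e σ) ≠ 0 := by
      rw [doubleProd_eq_mul_left hτ hσ] at h1
      exact left_ne_zero_of_mul h1
    rw [← doubleProd_eq_mul_left hτ hσ]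
    exact ⟨h1, h2, rfl⟩
  · intro τ σ hτ hσ h z hz
    rw [lat_neg] at hz
    obtain ⟨h1, h2, h3⟩ := h z hz
    obtain ⟨h1', -, -⟩ := h (z + τ) (by rwa [add_mid_mem_lat_iff])
    have hs : ∀ w, symb (e w) (e (-τ)) (e σ) = (symb (e (w + τ)) (e τ) (e σ))⁻¹ := by
      intro w
      rw [e_neg, symb_inv_left _ _ (e_ne_zero τ) (norm_e_ne_one hτ), e_add, mul_comm (e w)]
    rw [hs, hs, neg_add_cancel_right]
    refine ⟨inv_ne_zero h1', h2, ?_⟩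
    rw [h3]
    field_simp
  · intro τ σ hτ hσ h z hz
    rw [lat_swap, lat_neg, lat_swap] at hz
    obtain ⟨h1, h2, h3⟩ := h (z + σ) (by rwa [add_right_mem_lat_iff])
    have hs : ∀ w q, symb (e w) q (e (-σ)) = (symb (e (w + σ)) q (e σ))⁻¹ := by
      intro w q
      rw [e_neg, symb_inv_right _ _ (e_ne_zero σ) (norm_e_ne_one hσ), e_add, mul_comm (e w)]
    rw [hs, hs, hs, add_right_comm z τ σ, h3, mul_inv]
    rw [h3] at h1
    exact ⟨by rw [← mul_inv]; exact inv_ne_zero h1, inv_ne_zero h2, rfl⟩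

/-! ### The elliptic gamma function -/

theorem Gam_eq (z τ σ : ℂ) :
    Gam z τ σ = symb (e (τ + σ - z)) (e τ) (e σ) / symb (e z) (e τ) (e σ) := by
  rw [Gam, e_sub, e_add]

theorem Gam_comm (z τ σ : ℂ) : Gam z τ σ = Gam z σ τ := by
  rw [Gam, Gam, symb_comm, symb_comm (e z), mul_comm (e τ)]

theorem Gam_add_one (z τ σ : ℂ) : Gam (z + 1) τ σ = Gam z τ σ := by
  rw [Gam, Gam, e_add_one]

theorem Gam_add_one_left (z τ σ : ℂ) : Gam z (τ + 1) σ = Gam z τ σ := by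
  rw [Gam, Gam, e_add_one]

theorem Gam_add_one_right (z τ σ : ℂ) : Gam z τ (σ + 1) = Gam z τ σ := by
  rw [Gam, Gam, e_add_one]

theorem Gam_reflect (z τ σ : ℂ) : Gam (τ + σ - z) τ σ = (Gam z τ σ)⁻¹ := by
  rw [Gam_eq, Gam_eq, inv_div, sub_sub_cancel]

theorem Gam_neg_left (z : ℂ) {τ : ℂ} (σ : ℂ) (hτ : τ.im ≠ 0) :
    Gam z (-τ) σ = (Gam (z + τ) τ σ)⁻¹ := by
  rw [Gam_eq, Gam_eq, e_neg, symb_inv_left _ _ (e_ne_zero τ) (norm_e_ne_one hτ),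
    symb_inv_left _ _ (e_ne_zero τ) (norm_e_ne_one hτ), ← e_add, ← e_add, inv_div_inv, inv_div]
  ring_nf

theorem Gam_neg_right (z τ : ℂ) {σ : ℂ} (hσ : σ.im ≠ 0) :
    Gam z τ (-σ) = (Gam (z + σ) τ σ)⁻¹ := by
  rw [Gam_comm, Gam_neg_left _ _ hσ, Gam_comm]

theorem Gam_neg_neg (z : ℂ) {τ σ : ℂ} (hτ : τ.im ≠ 0) (hσ : σ.im ≠ 0) :
    Gam (-z) (-τ) (-σ) = (Gam z τ σ)⁻¹ := by
  rw [Gam_neg_left _ _ hτ, Gam_neg_right _ _ hσ, inv_inv, ← Gam_reflect]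
  ring_nf

/-- `N / D` represents `Γ(·, τ, σ)` as a quotient of entire functions without common zeros. -/
structure IsRep (τ σ : ℂ) (N D : ℂ → ℂ) : Prop where
  diff_num : Differentiable ℂ N
  diff_den : Differentiable ℂ D
  eq_div : ∀ z, Gam z τ σ = N z / D z
  num_or_den_ne_zero : ∀ z, N z ≠ 0 ∨ D z ≠ 0
  ne_zero_of_strip : ∀ z, |(2 * z - τ - σ).im| < |τ.im| + |σ.im| → N z ≠ 0 ∧ D z ≠ 0
  ne_zero_of_notMem : ∀ z ∉ lat 1 τ σ, N z ≠ 0 ∧ D z ≠ 0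

/-- For positive imaginary parts N and D are the two double products. D has no zero where Im z > 0
and N none where Im z < Im τ + Im σ; these half-planes cover the plane and meet in the strip.
Replacing τ by -τ exchanges N and D after a shift by τ. -/
theorem exists_isRep {τ σ : ℂ} (hτ : τ.im ≠ 0) (hσ : σ.im ≠ 0) : ∃ N D, IsRep τ σ N D := by
  have key : ∀ τ σ : ℂ, τ.im ≠ 0 → σ.im ≠ 0 → (∃ N D, IsRep τ σ N D) →
      ∃ N D, IsRep (-τ) σ N D := by
    rintro τ σ hτ hσ ⟨N, D, h⟩
    refine ⟨fun z => D (z + τ), fun z => N (z + τ), ?_, ?_, ?_, ?_, ?_, ?_⟩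
    · exact h.diff_den.comp (differentiable_id.add_const τ)
    · exact h.diff_num.comp (differentiable_id.add_const τ)
    · intro z; rw [Gam_neg_left _ _ hτ, h.eq_div, inv_div]
    · intro z; exact (h.num_or_den_ne_zero _).symm
    · intro z hz
      refine (h.ne_zero_of_strip (z + τ) ?_).symm
      have : 2 * (z + τ) - τ - σ = 2 * z - -τ - σ := by ring
      rw [this]; simpa using hz
    · intro z hz
      rw [lat_neg] at hz
      exact (h.ne_zero_of_notMem (z + τ) (by rwa [add_mid_mem_lat_iff])).symm
  have swap : ∀ τ σ : ℂ, (∃ N D, IsRep τ σ N D) → ∃ N D, IsRep σ τ N D := by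
    rintro τ σ ⟨N, D, h⟩
    refine ⟨N, D, h.diff_num, h.diff_den, fun z => by rw [Gam_comm, h.eq_div],
      h.num_or_den_ne_zero, fun z hz => h.ne_zero_of_strip z ?_, fun z hz => ?_⟩
    · rw [sub_right_comm, add_comm |τ.im|]; exact hz
    · rw [lat_swap] at hz; exact h.ne_zero_of_notMem z hz
  refine im_sign_induction (p := fun τ σ => ∃ N D, IsRep τ σ N D) ?_ key
    (fun τ σ hτ hσ h => swap _ _ (key _ _ hσ hτ (swap _ _ h))) hτ hσ
  intro τ σ hτ hσ
  have hq := norm_e_lt_one_iff.2 hτ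
  have hr := norm_e_lt_one_iff.2 hσ
  refine ⟨fun z => doubleProd (e (τ + σ - z)) (e τ) (e σ),
    fun z => doubleProd (e z) (e τ) (e σ), ?_, ?_, ?_, ?_, ?_, ?_⟩
  · exact (differentiable_doubleProd hq hr).comp
      (differentiable_e.comp (differentiable_id.const_sub (τ + σ)))
  · exact (differentiable_doubleProd hq hr).comp differentiable_e
  · intro z
    rw [Gam_eq, symb_of_norm_lt_one _ hq hr, symb_of_norm_lt_one _ hq hr]
  · intro z
    rcases lt_or_ge 0 z.im with hz | hz
    · exact Or.inr (doubleProd_ne_zero_of_norm_lt_one hq hr (norm_e_lt_one_iff.2 hz))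
    · refine Or.inl (doubleProd_ne_zero_of_norm_lt_one hq hr (norm_e_lt_one_iff.2 ?_))
      simp only [Complex.sub_im, Complex.add_im]; linarith
  · intro z hz
    rw [abs_of_pos hτ, abs_of_pos hσ, abs_lt] at hz
    simp only [Complex.sub_im, Complex.mul_im, Complex.re_ofNat, Complex.im_ofNat] at hz
    exact ⟨doubleProd_ne_zero_of_norm_lt_one hq hr (norm_e_lt_one_iff.2 (by
        simp only [Complex.sub_im, Complex.add_im]; linarith)),
      doubleProd_ne_zero_of_norm_lt_one hq hr (norm_e_lt_one_iff.2 (by linarith))⟩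
  · intro z hz
    rw [← symb_of_norm_lt_one _ hq hr, ← symb_of_norm_lt_one _ hq hr]
    refine ⟨(symb_split hτ.ne' hσ.ne' _ fun h => hz ?_).1, (symb_split hτ.ne' hσ.ne' _ hz).1⟩
    rw [← neg_mem_lat_iff, ← add_mem_lat_iff 1 τ σ _ 0 1 1]
    convert h using 1
    push_cast; ring

theorem Gam_ne_zero {z τ σ : ℂ} (hτ : τ.im ≠ 0) (hσ : σ.im ≠ 0) (hz : z ∉ lat 1 τ σ) :
    Gam z τ σ ≠ 0 := by
  obtain ⟨N, D, h⟩ := exists_isRep hτ hσ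
  rw [h.eq_div]
  exact div_ne_zero (h.ne_zero_of_notMem z hz).1 (h.ne_zero_of_notMem z hz).2

/-- Here τ + σ - z = z - 1, so numerator and denominator are the same symbol, and the point lies in
the strip where neither vanishes. -/
theorem Gam_eq_one {z τ σ : ℂ} (hτ : τ.im ≠ 0) (hσ : σ.im ≠ 0) (hz : 2 * z - τ - σ = 1) :
    Gam z τ σ = 1 := by
  obtain ⟨N, D, h⟩ := exists_isRep hτ hσ
  have hs := h.ne_zero_of_strip z (by
    rw [hz]
    simpa using add_pos (abs_pos.2 hτ) (abs_pos.2 hσ))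
  have h0 : Gam z τ σ ≠ 0 := by rw [h.eq_div]; exact div_ne_zero hs.1 hs.2
  have he : e (τ + σ - z) = e z := by
    rw [← e_add_one]
    congr 1
    linear_combination -hz
  rw [Gam_eq, he] at h0 ⊢
  exact div_self fun h => h0 (by rw [h, div_zero])

/-! ### The theta function -/

/-- The theta function `(x; r) (r / x; r)` with `x = e z`, `r = e σ`. -/
noncomputable def theta (z σ : ℂ) : ℂ := symb (e z) 0 (e σ) * symb (e (σ - z)) 0 (e σ)

theorem theta_neg (z : ℂ) {σ : ℂ} (hσ : σ.im ≠ 0) : theta z (-σ) = (theta (z + σ) σ)⁻¹ := by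
  rw [theta, theta, e_neg, symb_inv_right _ _ (e_ne_zero σ) (norm_e_ne_one hσ),
    symb_inv_right _ _ (e_ne_zero σ) (norm_e_ne_one hσ), ← e_add, ← e_add, mul_inv]
  ring_nf

theorem Gam_add_left {z τ σ : ℂ} (hτ : τ.im ≠ 0) (hσ : σ.im ≠ 0) (hz : z ∉ lat 1 τ σ) :
    Gam (z + τ) τ σ = theta z σ * Gam z τ σ := by
  have h1 := symb_split hτ hσ z hz
  have h2 := symb_split hτ hσ (z + τ) (by rwa [add_mid_mem_lat_iff])
  have hz' : σ - z ∉ lat 1 τ σ := by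
    rw [← neg_mem_lat_iff, ← add_right_mem_lat_iff]
    convert hz using 2
    ring
  have h3 := symb_split hτ hσ (σ - z) hz'
  have h4 := symb_split hτ hσ (σ - z + τ) (by rwa [add_mid_mem_lat_iff])
  rw [Gam_eq, Gam_eq, theta, show τ + σ - (z + τ) = σ - z by ring,
    show τ + σ - z = σ - z + τ by ring, h3.2.2, h1.2.2]
  have := h2.1
  have := h1.2.1
  field_simp

/-- The parameter τ is auxiliary: theta is a factor of the nonzero value Γ(z + τ, τ, σ). -/
theorem theta_ne_zero {z τ σ : ℂ} (hτ : τ.im ≠ 0) (hσ : σ.im ≠ 0) (hz : z ∉ lat 1 τ σ) :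
    theta z σ ≠ 0 := by
  have h := Gam_ne_zero hτ hσ (z := z + τ) (by rwa [add_mid_mem_lat_iff])
  rw [Gam_add_left hτ hσ hz] at h
  exact left_ne_zero_of_mul h

/-! ### Doubly periodic functions -/

theorem exists_real_coord {a b : ℂ} (hab : (a / b).im ≠ 0) (z : ℂ) :
    ∃ s t : ℝ, z = s * a + t * b := by
  have hb : b ≠ 0 := by rintro rfl; simp at hab
  refine ⟨(z / b).im / (a / b).im, (z / b).re - (z / b).im / (a / b).im * (a / b).re, ?_⟩
  have h : z / b = ((z / b).im / (a / b).im : ℝ) * (a / b) +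
      ((z / b).re - (z / b).im / (a / b).im * (a / b).re : ℝ) := by
    apply Complex.ext
    · simp
    · simp [hab]
  set s : ℝ := (z / b).im / (a / b).im
  set t : ℝ := (z / b).re - s * (a / b).re
  field_simp at h
  linear_combination h

theorem apply_add_int_mul {S : Set ℂ} {a : ℂ} {f : ℂ → ℂ} (hS : ∀ z, z + a ∈ S ↔ z ∈ S)
    (hf : ∀ z ∉ S, f (z + a) = f z) (m : ℤ) :
    ∀ z ∉ S, z + m * a ∉ S ∧ f (z + m * a) = f z := by
  induction m using Int.induction_on with
  | zero => intro z hz; simpa using hz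
  | succ k ih =>
    intro z hz
    obtain ⟨h1, h2⟩ := ih z hz
    have : z + ((k + 1 : ℤ) : ℂ) * a = z + ((k : ℤ) : ℂ) * a + a := by push_cast; ring
    rw [this]
    exact ⟨by rwa [hS], by rw [hf _ h1, h2]⟩
  | pred k ih =>
    intro z hz
    obtain ⟨h1, h2⟩ := ih z hz
    have : z + ((-k : ℤ) : ℂ) * a = z + ((-k - 1 : ℤ) : ℂ) * a + a := by push_cast; ring
    rw [this] at h1 h2
    rw [hS] at h1
    exact ⟨h1, by rw [← h2, hf _ h1]⟩

/-- A function that is holomorphic on an open set whose translates by a lattice cover the plane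
and that has the lattice among its periods, off a set with dense complement, is constant. -/
theorem exists_const_of_periodic {a b : ℂ} (hab : (a / b).im ≠ 0) {S U : Set ℂ} {f : ℂ → ℂ}
    (hS : Dense Sᶜ) (hSa : ∀ z, z + a ∈ S ↔ z ∈ S) (hSb : ∀ z, z + b ∈ S ↔ z ∈ S)
    (hfa : ∀ z ∉ S, f (z + a) = f z) (hfb : ∀ z ∉ S, f (z + b) = f z)
    (hU : IsOpen U) (hf : DifferentiableOn ℂ f U)
    (hcov : ∀ z, ∃ m n : ℤ, z + (m * a + n * b) ∈ U) :
    ∃ c, (∀ z ∈ U, f z = c) ∧ ∀ z ∉ S, f z = c := by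
  have hper : ∀ m n : ℤ, ∀ z ∉ S, f (z + (m * a + n * b)) = f z := by
    intro m n z hz
    obtain ⟨h1, h2⟩ := apply_add_int_mul hSa hfa m z hz
    rw [← add_assoc, (apply_add_int_mul hSb hfb n _ h1).2, h2]
  have hshift : ∀ z c, z + c ∈ U → DifferentiableAt ℂ (fun w => f (w + c)) z := by
    intro z c hz
    exact DifferentiableAt.comp z (g := f) (hf.differentiableAt (hU.mem_nhds hz))
      (differentiableAt_id.add_const c)
  -- Two translates of z that both lie in U give the same value: the two shifted functions are
  -- continuous at z and agree on the dense complement of S.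
  have key : ∀ z, ∀ m n m' n' : ℤ, z + (m * a + n * b) ∈ U → z + (m' * a + n' * b) ∈ U →
      f (z + (m * a + n * b)) = f (z + (m' * a + n' * b)) := by
    intro z m n m' n' h h'
    have : (nhdsWithin z Sᶜ).NeBot := mem_closure_iff_nhdsWithin_neBot.1 (hS z)
    refine tendsto_nhds_unique_of_eventuallyEq
      ((hshift _ _ h).continuousAt.tendsto.mono_left (nhdsWithin_le_nhds (s := Sᶜ)))
      ((hshift _ _ h').continuousAt.tendsto.mono_left (nhdsWithin_le_nhds (s := Sᶜ))) ?_
    filter_upwards [self_mem_nhdsWithin] with w hw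
    rw [hper m n w hw, hper m' n' w hw]
  choose m n hmn using hcov
  -- By `key`, g does not depend on the chosen translate. It is the entire, doubly periodic
  -- continuation of f, free of the arbitrary values f may take outside U.
  let g : ℂ → ℂ := fun z => f (z + (m z * a + n z * b))
  have hg : ∀ z, ∀ m' n' : ℤ, z + (m' * a + n' * b) ∈ U → g z = f (z + (m' * a + n' * b)) :=
    fun z m' n' h => key z _ _ _ _ (hmn z) h
  have hgd : Differentiable ℂ g := by
    intro z
    refine (hshift _ _ (hmn z)).congr_of_eventuallyEq ?_
    have hc : ContinuousAt (fun w => w + (m z * a + n z * b)) z := by fun_prop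
    filter_upwards [hc (hU.mem_nhds (hmn z))] with w hw
    exact hg w _ _ hw
  have hgp : ∀ z, ∀ k l : ℤ, g (z + (k * a + l * b)) = g z := by
    intro z k l
    have h := hmn (z + (k * a + l * b))
    have he : z + (k * a + l * b) + (m (z + (k * a + l * b)) * a + n (z + (k * a + l * b)) * b) =
      z + ((k + m (z + (k * a + l * b)) : ℤ) * a + (l + n (z + (k * a + l * b)) : ℤ) * b) := by
      push_cast; ring
    rw [he] at h
    rw [hg z _ _ h, ← he]
  let K : Set ℂ := (fun p : ℝ × ℝ => (p.1 * a + p.2 * b : ℂ)) '' (Set.Icc 0 1 ×ˢ Set.Icc 0 1)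
  have hK : IsCompact K := (isCompact_Icc.prod isCompact_Icc).image (by fun_prop)
  have hrange : Set.range g ⊆ g '' K := by
    rintro _ ⟨z, rfl⟩
    obtain ⟨s, t, rfl⟩ := exists_real_coord hab z
    refine ⟨(Int.fract s : ℝ) * a + (Int.fract t : ℝ) * b,
      ⟨(Int.fract s, Int.fract t), ⟨⟨Int.fract_nonneg s, (Int.fract_lt_one s).le⟩,
        ⟨Int.fract_nonneg t, (Int.fract_lt_one t).le⟩⟩, rfl⟩, ?_⟩
    rw [← hgp _ ⌊s⌋ ⌊t⌋]
    congr 1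
    have hs : (s : ℂ) = (⌊s⌋ : ℤ) + (Int.fract s : ℝ) := by
      exact_mod_cast (Int.floor_add_fract s).symm
    have ht : (t : ℂ) = (⌊t⌋ : ℤ) + (Int.fract t : ℝ) := by
      exact_mod_cast (Int.floor_add_fract t).symm
    rw [hs, ht]; ring
  have hbd : Bornology.IsBounded (Set.range g) :=
    (hK.image hgd.continuous).isBounded.subset hrange
  obtain ⟨c, hc⟩ := hgd.exists_const_forall_eq_of_bounded hbd
  refine ⟨c, fun z hz => ?_, fun z hz => ?_⟩
  · rw [← hc z, hg z 0 0 (by simpa using hz)]; simp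
  · rw [← hc z]; exact (hper _ _ z hz).symm

/-- The imaginary part of `w * conj v`, an alternating real bilinear form. -/
def wedge (w v : ℂ) : ℝ := w.im * v.re - w.re * v.im

theorem im_div_eq_wedge (w v : ℂ) : (w / v).im = wedge w v / Complex.normSq v := by
  rw [Complex.div_im, wedge]; ring

theorem wedge_comb (a b v : ℂ) (s t : ℝ) :
    wedge (s * a + t * b) v = s * wedge a v + t * wedge b v := by
  simp [wedge]; ring

theorem wedge_self (a : ℂ) : wedge a a = 0 := by rw [wedge]; ring

theorem wedge_swap (a b : ℂ) : wedge a b = -wedge b a := by simp only [wedge]; ring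

/-- The open hexagon centred at `(a + b + c) / 2` with sides parallel to `a`, `b`, `c`. -/
def hexagon (a b c : ℂ) : Set ℂ :=
  {z | |((2 * z - a - b) / c).im| < |(a / c).im| + |(b / c).im| ∧
    |((2 * z - b - c) / a).im| < |(b / a).im| + |(c / a).im| ∧
    |((2 * z - c - a) / b).im| < |(c / b).im| + |(a / b).im|}

theorem isOpen_hexagon (a b c : ℂ) : IsOpen (hexagon a b c) := by
  have h : ∀ a b c : ℂ, Continuous fun z : ℂ => |((2 * z - a - b) / c).im| := fun a b c =>
    continuous_abs.comp (Complex.continuous_im.comp (by fun_prop))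
  exact (isOpen_lt (h _ _ _) continuous_const).inter
    ((isOpen_lt (h _ _ _) continuous_const).inter (isOpen_lt (h _ _ _) continuous_const))

theorem abs_im_div_lt_iff {x y w v : ℂ} (hv : v ≠ 0) :
    |(w / v).im| < |(x / v).im| + |(y / v).im| ↔ |wedge w v| < |wedge x v| + |wedge y v| := by
  have h : 0 < Complex.normSq v := Complex.normSq_pos.2 hv
  simp only [im_div_eq_wedge, abs_div, abs_of_pos h, ← add_div]
  exact div_lt_div_iff_of_pos_right h

/-- Write 2z - a - b - c = sa + tb. Lattice shifts move s and t by even integers, so both can be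
brought into [-1, 1]. The two conditions relative to a and b then hold because c contributes a
strictly positive term; the condition relative to c can fail only when |s| = |t| = 1, where the
signs can be chosen to cancel. -/
theorem exists_add_mem_hexagon {a b c : ℂ} (hab : (a / b).im ≠ 0) (hbc : (b / c).im ≠ 0)
    (hac : (a / c).im ≠ 0) (z : ℂ) : ∃ m n : ℤ, z + (m * a + n * b) ∈ hexagon a b c := by
  have hb : b ≠ 0 := by rintro rfl; simp at hab
  have hc : c ≠ 0 := by rintro rfl; simp at hbc
  have ha : a ≠ 0 := by rintro rfl; simp at hab
  have wbc : wedge b c ≠ 0 := fun h => hbc (by rw [im_div_eq_wedge, h, zero_div])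
  have wac : wedge a c ≠ 0 := fun h => hac (by rw [im_div_eq_wedge, h, zero_div])
  obtain ⟨s, t, hst⟩ := exists_real_coord hab (2 * z - a - b - c)
  -- it suffices to find integers with `|s + 2m|, |t + 2n| ≤ 1` and a strict inequality for `c`
  suffices h : ∃ m n : ℤ, |s + 2 * m| ≤ 1 ∧ |t + 2 * n| ≤ 1 ∧
      |(s + 2 * m) * wedge a c + (t + 2 * n) * wedge b c| < |wedge a c| + |wedge b c| by
    obtain ⟨m, n, h1, h2, h3⟩ := h
    have hz : 2 * (z + (m * a + n * b)) =
        ((s + 2 * m : ℝ) * a + (t + 2 * n : ℝ) * b) + a + b + c := by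
      push_cast; linear_combination hst
    refine ⟨m, n, ?_, ?_, ?_⟩
    · rw [abs_im_div_lt_iff hc, hz]
      have : ((s + 2 * m : ℝ) * a + (t + 2 * n : ℝ) * b) + a + b + c - a - b =
        ((s + 2 * m : ℝ) * a + (t + 2 * n : ℝ) * b) + c := by ring
      have hw : wedge (((s + 2 * m : ℝ) * a + (t + 2 * n : ℝ) * b) + c) c =
        wedge ((s + 2 * m : ℝ) * a + (t + 2 * n : ℝ) * b) c := by
          simp only [wedge, Complex.add_im, Complex.add_re]; ring
      rwa [this, hw, wedge_comb]
    · rw [abs_im_div_lt_iff ha, hz]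
      have : ((s + 2 * m : ℝ) * a + (t + 2 * n : ℝ) * b) + a + b + c - b - c =
        ((s + 2 * m : ℝ) * a + (t + 2 * n : ℝ) * b) + a := by ring
      have hw : wedge (((s + 2 * m : ℝ) * a + (t + 2 * n : ℝ) * b) + a) a =
        wedge ((s + 2 * m : ℝ) * a + (t + 2 * n : ℝ) * b) a := by
          simp only [wedge, Complex.add_im, Complex.add_re]; ring
      rw [this, hw, wedge_comb, wedge_self, mul_zero, zero_add, abs_mul]
      have h4 : |t + 2 * n| * |wedge b a| ≤ |wedge b a| :=
        mul_le_of_le_one_left (abs_nonneg _) h2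
      have h5 : 0 < |wedge c a| := by rw [wedge_swap, abs_neg]; exact abs_pos.2 wac
      linarith
    · rw [abs_im_div_lt_iff hb, hz]
      have : ((s + 2 * m : ℝ) * a + (t + 2 * n : ℝ) * b) + a + b + c - c - a =
        ((s + 2 * m : ℝ) * a + (t + 2 * n : ℝ) * b) + b := by ring
      have hw : wedge (((s + 2 * m : ℝ) * a + (t + 2 * n : ℝ) * b) + b) b =
        wedge ((s + 2 * m : ℝ) * a + (t + 2 * n : ℝ) * b) b := by
          simp only [wedge, Complex.add_im, Complex.add_re]; ring
      rw [this, hw, wedge_comb, wedge_self, mul_zero, add_zero, abs_mul]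
      have h4 : |s + 2 * m| * |wedge a b| ≤ |wedge a b| :=
        mul_le_of_le_one_left (abs_nonneg _) h1
      have h5 : 0 < |wedge c b| := by rw [wedge_swap, abs_neg]; exact abs_pos.2 wbc
      linarith
  have hred : ∀ x : ℝ, ∃ m : ℤ, -1 ≤ x + 2 * m ∧ x + 2 * m < 1 := by
    intro x
    refine ⟨-⌊(x + 1) / 2⌋, ?_, ?_⟩
    · push_cast; linarith [Int.floor_le ((x + 1) / 2)]
    · push_cast; linarith [Int.lt_floor_add_one ((x + 1) / 2)]
  obtain ⟨m, hm1, hm2⟩ := hred s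
  obtain ⟨n, hn1, hn2⟩ := hred t
  have hA := abs_pos.2 wac
  have hB := abs_pos.2 wbc
  have hm : |s + 2 * m| ≤ 1 := abs_le.2 ⟨hm1, hm2.le⟩
  have hn : |t + 2 * n| ≤ 1 := abs_le.2 ⟨hn1, hn2.le⟩
  have htri : |(s + 2 * m) * wedge a c + (t + 2 * n) * wedge b c| ≤
      |s + 2 * m| * |wedge a c| + |t + 2 * n| * |wedge b c| := by
    rw [← abs_mul, ← abs_mul]; exact abs_add_le _ _
  rcases hm1.lt_or_eq with hm1 | hm1
  · refine ⟨m, n, hm, hn, htri.trans_lt ?_⟩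
    have : |s + 2 * m| < 1 := abs_lt.2 ⟨hm1, hm2⟩
    nlinarith
  rcases hn1.lt_or_eq with hn1 | hn1
  · refine ⟨m, n, hm, hn, htri.trans_lt ?_⟩
    have : |t + 2 * n| < 1 := abs_lt.2 ⟨hn1, hn2⟩
    nlinarith
  -- both coordinates are `-1`: use `(-1, -1)` or `(1, -1)` according to the signs
  rcases le_or_gt (wedge a c * wedge b c) 0 with h | h
  · refine ⟨m, n, hm, hn, ?_⟩
    rw [← hm1, ← hn1]
    rcases wac.lt_or_gt with h1 | h1 <;> rcases wbc.lt_or_gt with h2 | h2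
    · nlinarith
    · rw [abs_of_neg h1, abs_of_pos h2, abs_lt]; constructor <;> linarith
    · rw [abs_of_pos h1, abs_of_neg h2, abs_lt]; constructor <;> linarith
    · nlinarith
  · have hm' : s + 2 * ((m + 1 : ℤ) : ℝ) = 1 := by push_cast; linarith
    refine ⟨m + 1, n, by rw [hm', abs_one], hn, ?_⟩
    rw [hm', ← hn1]
    rcases wac.lt_or_gt with h1 | h1 <;> rcases wbc.lt_or_gt with h2 | h2
    · rw [abs_of_neg h1, abs_of_neg h2, abs_lt]; constructor <;> linarith
    · nlinarith
    · nlinarith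
    · rw [abs_of_pos h1, abs_of_pos h2, abs_lt]; constructor <;> linarith

/-! ### Modular transformation of the theta function -/

theorem theta_of_im_pos (z : ℂ) {σ : ℂ} (hσ : 0 < σ.im) :
    theta z σ = doubleProd (e z) 0 (e σ) * doubleProd (e (σ - z)) 0 (e σ) := by
  have h0 : ‖(0 : ℂ)‖ < 1 := by simp
  rw [theta, symb_of_norm_lt_one _ h0 (norm_e_lt_one_iff.2 hσ),
    symb_of_norm_lt_one _ h0 (norm_e_lt_one_iff.2 hσ)]

theorem theta_add_one (z σ : ℂ) : theta (z + 1) σ = theta z σ := by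
  rw [theta, theta, e_add_one, e_sub, e_add_one, ← e_sub]

theorem theta_add (z : ℂ) {σ : ℂ} (hσ : 0 < σ.im) :
    theta (z + σ) σ = -e (-z) * theta z σ := by
  have hr := norm_e_lt_one_iff.2 hσ
  rw [theta_of_im_pos _ hσ, theta_of_im_pos _ hσ, doubleProd_zero_eq_one_sub_mul hr (e z),
    show σ - (z + σ) = -z by ring, doubleProd_zero_eq_one_sub_mul hr (e (-z)), ← e_add, ← e_add,
    ← sub_eq_add_neg, add_comm σ z]
  have h : e (-z) * e z = 1 := by rw [← e_add, neg_add_cancel, e_zero]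
  linear_combination (-doubleProd (e (z + σ)) 0 (e σ) * doubleProd (e (σ - z)) 0 (e σ)) * h

theorem theta_duplication (z : ℂ) {σ : ℂ} (hσ : 0 < σ.im) :
    theta z σ * theta (z + 1 / 2) σ * (theta (z + σ / 2) σ * theta (z + σ / 2 + 1 / 2) σ) =
      theta (2 * z) σ := by
  have hs : ‖e (σ / 2)‖ < 1 := norm_e_lt_one_iff.2 (by simpa using hσ)
  have hsq : e σ = e (σ / 2) ^ 2 := by rw [← e_nat_mul]; congr 1; push_cast; ring
  have hhalf : ∀ w, e (w + 1 / 2) = -e w := by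
    intro w
    have : e (1 / 2) = -1 := by
      rw [e, ← Complex.exp_pi_mul_I]; ring_nf
    rw [e_add, this]; ring
  simp only [theta_of_im_pos _ hσ]
  have h1 := doubleProd_zero_duplication hs (e z)
  have h2 := doubleProd_zero_duplication hs (e (σ / 2 - z))
  have e1 : e (σ - (z + 1 / 2)) = -e (σ - z) := by
    rw [← e_add_one, ← hhalf]; ring_nf
  have e2 : e (σ - (z + σ / 2)) = e (σ / 2 - z) := by ring_nf
  have e3 : e (σ - (z + σ / 2 + 1 / 2)) = -e (σ / 2 - z) := by
    rw [← e_add_one, ← hhalf]; ring_nf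
  have e4 : e (z + σ / 2) = e (σ / 2) * e z := by rw [e_add, mul_comm]
  have e5 : e (σ - z) = e (σ / 2) * e (σ / 2 - z) := by rw [← e_add]; ring_nf
  have e6 : e (2 * z) = e z ^ 2 := by rw [← e_nat_mul]; simp
  have e7 : e (σ - 2 * z) = e (σ / 2 - z) ^ 2 := by
    rw [← e_nat_mul]; congr 1; push_cast; ring
  rw [hhalf, hhalf, e1, e2, e3, e4, e5, e6, e7, hsq, ← h1, ← h2]
  ring

/-- The Bernoulli polynomial `B_{2,2}(z | a, b)`. -/
noncomputable def B22 (z a b : ℂ) : ℂ :=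
  z ^ 2 / (a * b) - z * (a + b) / (a * b) + (a ^ 2 + b ^ 2 + 3 * a * b) / (6 * a * b)

/-- The differences of B₂₂(z|1,τ) under z ↦ z + 1 and z ↦ z + τ are 2z/τ - 1 and 2z - 1; this
converts them into theta multipliers. -/
theorem exp_pi_mul_two_mul_sub_one (z : ℂ) :
    Complex.exp (Complex.I * Real.pi * (2 * z - 1)) = -e z := by
  rw [e, mul_sub, Complex.exp_sub, mul_one, mul_comm Complex.I, Complex.exp_pi_mul_I]
  ring_nf

theorem differentiable_dslope {f : ℂ → ℂ} (hf : Differentiable ℂ f) (z : ℂ) :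
    Differentiable ℂ (dslope f z) :=
  differentiableOn_univ.1 ((Complex.differentiableOn_dslope Filter.univ_mem).2
    hf.differentiableOn)

theorem hasDerivAt_one_sub_e_mul (k : ℂ) :
    HasDerivAt (fun z => 1 - e (k * z)) (-(2 * Real.pi * Complex.I * k)) 0 := by
  have h : HasDerivAt (fun z : ℂ => 2 * Real.pi * Complex.I * (k * z))
      (2 * Real.pi * Complex.I * (k * 1)) 0 := ((hasDerivAt_id 0).const_mul k).const_mul _
  simpa [e] using (h.cexp.const_sub 1)

theorem dslope_one_sub_e_mul {k z : ℂ} (hz : z ≠ 0) :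
    dslope (fun z => 1 - e (k * z)) 0 z = (1 - e (k * z)) / z := by
  rw [dslope_of_ne _ hz, slope_def_field]
  simp [e_zero]

theorem dslope_one_sub_e_mul_ne_zero {k z : ℂ} (hk : k ≠ 0)
    (h : ∀ n : ℤ, k * z = n → z = 0) : dslope (fun z => 1 - e (k * z)) 0 z ≠ 0 := by
  rcases eq_or_ne z 0 with rfl | hz
  · rw [dslope_same, (hasDerivAt_one_sub_e_mul k).deriv]
    simp [hk, Real.pi_ne_zero]
  · rw [dslope_one_sub_e_mul hz]
    refine div_ne_zero (fun h1 => hz ?_) hz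
    obtain ⟨n, hn⟩ := e_eq_one_iff.1 (sub_eq_zero.1 h1).symm
    exact h n hn

theorem theta_eq_one_sub_mul (z : ℂ) {σ : ℂ} (hσ : 0 < σ.im) :
    theta z σ = (1 - e z) * (doubleProd (e (σ + z)) 0 (e σ) * doubleProd (e (σ - z)) 0 (e σ)) := by
  rw [theta_of_im_pos _ hσ, doubleProd_zero_eq_one_sub_mul (norm_e_lt_one_iff.2 hσ), e_add,
    mul_assoc]

theorem theta_reflect (z σ : ℂ) : theta (σ - z) σ = theta z σ := by
  rw [theta, theta, sub_sub_cancel, mul_comm]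

/-- The multipliers of theta and of exp(iπ B₂₂) cancel, so the quotient has periods 1 and τ. On a
neighbourhood of the half-open period parallelogram the denominator vanishes only at z = 0, where
the numerator vanishes too, so the quotient continues to an entire function. -/
theorem exists_theta_modular_const {τ : ℂ} (hτ : 0 < τ.im) :
    ∃ c : ℂ, ∀ z ∉ lat 1 τ 0,
      theta z τ * Complex.exp (Complex.I * Real.pi * B22 z 1 τ) / theta (-z / τ) (-1 / τ) = c := by
  have hτ0 : τ ≠ 0 := by rintro rfl; simp at hτ
  have hτ' : 0 < (-1 / τ).im := by
    rw [neg_div, one_div, Complex.neg_im, Complex.inv_im, neg_div, neg_neg]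
    exact div_pos hτ (Complex.normSq_pos.2 hτ0)
  have h1τ : ((1 : ℂ) / τ).im ≠ 0 := by
    rw [neg_div, Complex.neg_im] at hτ'
    linarith
  set τ' := -1 / τ with hτ'def
  have h0 : ‖(0 : ℂ)‖ < 1 := by simp
  have hr := norm_e_lt_one_iff.2 hτ
  have hr' := norm_e_lt_one_iff.2 hτ'
  -- Numerator and denominator are both divided by z, with `dslope` supplying the value at 0.
  let N : ℂ → ℂ := fun z => dslope (fun z => 1 - e (1 * z)) 0 z *
    (doubleProd (e (τ + z)) 0 (e τ) * doubleProd (e (τ - z)) 0 (e τ)) *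
      Complex.exp (Complex.I * Real.pi * B22 z 1 τ)
  let D : ℂ → ℂ := fun z => dslope (fun z => 1 - e (τ' * z)) 0 z *
    (doubleProd (e (τ' + τ' * z)) 0 (e τ') * doubleProd (e (τ' - τ' * z)) 0 (e τ'))
  have hde : ∀ k : ℂ, Differentiable ℂ fun z => 1 - e (k * z) := fun k =>
    (differentiable_e.comp (differentiable_id.const_mul k)).const_sub 1
  have hdp : ∀ {r : ℂ}, ‖r‖ < 1 → ∀ {g : ℂ → ℂ}, Differentiable ℂ g →
      Differentiable ℂ fun z => doubleProd (e (g z)) 0 r := fun hr g hg =>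
    (differentiable_doubleProd h0 hr).comp (differentiable_e.comp hg)
  have hN : Differentiable ℂ N := by
    refine ((differentiable_dslope (hde 1) 0).mul ((hdp hr ?_).mul (hdp hr ?_))).mul ?_
    · fun_prop
    · fun_prop
    · unfold B22; fun_prop
  have hD : Differentiable ℂ D := by
    refine (differentiable_dslope (hde τ') 0).mul ((hdp hr' ?_).mul (hdp hr' ?_)) <;> fun_prop
  let U : Set ℂ := {z | |z.im| < τ.im ∧ |(τ' * z).im| < τ'.im}
  have hU : IsOpen U :=
    (isOpen_lt (continuous_abs.comp Complex.continuous_im) continuous_const).inter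
      (isOpen_lt (continuous_abs.comp (Complex.continuous_im.comp (continuous_const_mul τ')))
        continuous_const)
  have hDU : ∀ z ∈ U, D z ≠ 0 := by
    rintro z ⟨hz1, hz2⟩
    have hz3 := abs_lt.1 hz2
    refine mul_ne_zero (dslope_one_sub_e_mul_ne_zero (by intro h; simp [h] at hτ') fun n hn => ?_)
      (mul_ne_zero (doubleProd_ne_zero_of_norm_lt_one h0 hr' (norm_e_lt_one_iff.2 ?_))
        (doubleProd_ne_zero_of_norm_lt_one h0 hr' (norm_e_lt_one_iff.2 ?_)))
    · have hzn : z = -n * τ := by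
        rw [← hn, hτ'def]; field_simp
      have hzi : z.im = -n * τ.im := by rw [hzn]; simp
      rw [hzi, abs_mul, abs_of_pos hτ, abs_neg] at hz1
      have hn1 : |(n : ℝ)| < 1 := by
        by_contra! hge
        nlinarith
      have hn0 : n = 0 := Int.abs_lt_one_iff.1 (by exact_mod_cast hn1)
      rw [hzn, hn0]; simp
    · rw [Complex.add_im]; linarith
    · rw [Complex.sub_im]; linarith
  have hfS : ∀ z ∉ lat 1 τ 0, N z / D z =
      theta z τ * Complex.exp (Complex.I * Real.pi * B22 z 1 τ) / theta (-z / τ) τ' := by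
    intro z hz
    have hz0 : z ≠ 0 := by rintro rfl; exact hz ⟨0, 0, 0, by simp⟩
    have hw : τ' * z = -z / τ := by rw [hτ'def]; ring
    simp only [N, D]
    rw [dslope_one_sub_e_mul hz0, dslope_one_sub_e_mul hz0, theta_eq_one_sub_mul _ hτ,
      theta_eq_one_sub_mul _ hτ', one_mul, ← hw]
    rw [div_mul_eq_mul_div, div_mul_eq_mul_div, div_mul_eq_mul_div, div_div_div_cancel_right₀ hz0]
  have hB1 : ∀ z, Complex.exp (Complex.I * Real.pi * B22 (z + 1) 1 τ) =
      -e (z / τ) * Complex.exp (Complex.I * Real.pi * B22 z 1 τ) := by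
    intro z
    rw [← exp_pi_mul_two_mul_sub_one, ← Complex.exp_add]
    congr 1
    unfold B22
    field_simp
    ring
  have hBτ : ∀ z, Complex.exp (Complex.I * Real.pi * B22 (z + τ) 1 τ) =
      -e z * Complex.exp (Complex.I * Real.pi * B22 z 1 τ) := by
    intro z
    rw [← exp_pi_mul_two_mul_sub_one, ← Complex.exp_add]
    congr 1
    unfold B22
    field_simp
    ring
  have hSone : ∀ z, z + 1 ∈ lat 1 τ 0 ↔ z ∈ lat 1 τ 0 := add_left_mem_lat_iff 1 τ 0
  have hSτ : ∀ z, z + τ ∈ lat 1 τ 0 ↔ z ∈ lat 1 τ 0 := add_mid_mem_lat_iff 1 τ 0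
  suffices h : ∃ c, (∀ z ∈ U, N z / D z = c) ∧ ∀ z ∉ lat 1 τ 0, N z / D z = c by
    obtain ⟨c, -, hc⟩ := h
    exact ⟨c, fun z hz => by rw [← hfS z hz]; exact hc z hz⟩
  refine exists_const_of_periodic (a := 1) (b := τ) h1τ (f := fun z => N z / D z)
    (dense_compl_lat 1 τ 0) hSone hSτ ?_ ?_ hU ?_ ?_
  · intro z hz
    rw [hfS _ hz, hfS _ (by rwa [hSone]), hB1, theta_add_one,
      show -(z + 1) / τ = -z / τ + τ' by rw [hτ'def]; ring, theta_add _ hτ',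
      show -(-z / τ) = z / τ by ring, mul_left_comm]
    exact mul_div_mul_left _ _ (neg_ne_zero.2 (e_ne_zero _))
  · intro z hz
    have h1 : e (-z) * e z = 1 := by rw [← e_add, neg_add_cancel, e_zero]
    rw [hfS _ hz, hfS _ (by rwa [hSτ]), hBτ, theta_add _ hτ, ← theta_add_one (-(z + τ) / τ),
      show -(z + τ) / τ + 1 = -z / τ by field_simp; ring]
    congr 1
    linear_combination (theta z τ * Complex.exp (Complex.I * Real.pi * B22 z 1 τ)) * h1
  · exact fun z hz => (hN z).differentiableWithinAt.div (hD z).differentiableWithinAt (hDU z hz)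
  · intro z
    obtain ⟨s, t, hst⟩ := exists_real_coord (a := 1) (b := τ) h1τ z
    refine ⟨-⌊s⌋, -⌊t⌋, ?_⟩
    have hs : z + ((-⌊s⌋ : ℤ) * 1 + (-⌊t⌋ : ℤ) * τ) = (Int.fract s : ℝ) + (Int.fract t : ℝ) * τ := by
      rw [hst, Int.fract, Int.fract]; push_cast; ring
    have hs' : τ' * ((Int.fract s : ℝ) + (Int.fract t : ℝ) * τ) =
        (Int.fract s : ℝ) * τ' - (Int.fract t : ℝ) := by
      rw [hτ'def]; field_simp; ring
    rw [hs]
    refine ⟨?_, ?_⟩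
    · rw [Complex.add_im, Complex.ofReal_im, zero_add, Complex.im_ofReal_mul, abs_mul,
        abs_of_pos hτ, abs_of_nonneg (Int.fract_nonneg t)]
      exact mul_lt_of_lt_one_left hτ (Int.fract_lt_one t)
    · rw [hs', Complex.sub_im, Complex.ofReal_im, sub_zero, Complex.im_ofReal_mul, abs_mul,
        abs_of_pos hτ', abs_of_nonneg (Int.fract_nonneg s)]
      exact mul_lt_of_lt_one_left hτ' (Int.fract_lt_one s)

/-- Multiplying the relations at z, z + 1/2, z + τ/2 and z + τ/2 + 1/2 gives, by duplication on both
sides, the relation at 2z. Hence c⁴ = c, and c ≠ 0. A cube root of unity is enough later, so c need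
not be evaluated. -/
theorem exists_theta_modular {τ : ℂ} (hτ : 0 < τ.im) :
    ∃ c : ℂ, c ^ 3 = 1 ∧ ∀ z ∉ lat 1 τ 0,
      theta z τ * Complex.exp (Complex.I * Real.pi * B22 z 1 τ) / theta (-z / τ) (-1 / τ) = c := by
  have hτ0 : τ ≠ 0 := by rintro rfl; simp at hτ
  have hτ' : 0 < (-1 / τ).im := by
    rw [neg_div, one_div, Complex.neg_im, Complex.inv_im, neg_div, neg_neg]
    exact div_pos hτ (Complex.normSq_pos.2 hτ0)
  obtain ⟨c, hc⟩ := exists_theta_modular_const hτ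
  refine ⟨c, ?_, hc⟩
  have hu : ∀ z ∉ lat 1 τ 0, theta z τ ≠ 0 := by
    intro z hz
    refine theta_ne_zero (τ := τ) hτ.ne' hτ.ne' fun ⟨l, m, n, h⟩ => hz ⟨l, m + n, 0, ?_⟩
    rw [h]; push_cast; ring
  have hv : ∀ z ∉ lat 1 τ 0, theta (-z / τ) (-1 / τ) ≠ 0 := by
    intro z hz
    refine theta_ne_zero (τ := -1 / τ) hτ'.ne' hτ'.ne' fun ⟨l, m, n, h⟩ => hz ⟨m + n, -l, 0, ?_⟩
    field_simp at h
    push_cast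
    linear_combination -h
  obtain ⟨w, hw⟩ := (dense_compl_lat 1 τ 0).nonempty
  -- If 2z avoids the lattice, then so do z and its translates by half periods.
  obtain ⟨z, rfl⟩ : ∃ z, w = 2 * z := ⟨w / 2, by ring⟩
  have hz : ∀ x : ℂ, (∃ m n : ℤ, 2 * x = 2 * z + (m * 1 + n * τ)) → x ∉ lat 1 τ 0 := by
    rintro x ⟨m, n, hx⟩ ⟨l, k, j, h⟩
    exact hw ⟨2 * l - m, 2 * k - n, 0, by push_cast; linear_combination 2 * h - hx⟩
  have m1 : z ∉ lat 1 τ 0 := hz _ ⟨0, 0, by simp⟩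
  have m2 : z + 1 / 2 ∉ lat 1 τ 0 := hz _ ⟨1, 0, by push_cast; ring⟩
  have m3 : z + τ / 2 ∉ lat 1 τ 0 := hz _ ⟨0, 1, by push_cast; ring⟩
  have m4 : z + τ / 2 + 1 / 2 ∉ lat 1 τ 0 := hz _ ⟨1, 1, by push_cast; ring⟩
  have hc' : ∀ z ∉ lat 1 τ 0, theta z τ * Complex.exp (Complex.I * Real.pi * B22 z 1 τ) =
      c * theta (-z / τ) (-1 / τ) := fun z hz => (div_eq_iff (hv z hz)).1 (hc z hz)
  have p1 := hc' _ m1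
  have p2 := hc' _ m2
  have p3 := hc' _ m3
  have p4 := hc' _ m4
  have p5 := hc' _ hw
  have d1 := theta_duplication z hτ
  have d2 : theta (-z / τ) (-1 / τ) * theta (-(z + 1 / 2) / τ) (-1 / τ) *
      (theta (-(z + τ / 2) / τ) (-1 / τ) * theta (-(z + τ / 2 + 1 / 2) / τ) (-1 / τ)) =
      theta (-(2 * z) / τ) (-1 / τ) := by
    rw [show -(2 * z) / τ = 2 * (-z / τ) by ring, ← theta_duplication _ hτ',
      ← theta_add_one (-(z + τ / 2) / τ), ← theta_add_one (-(z + τ / 2 + 1 / 2) / τ),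
      show -(z + 1 / 2) / τ = -z / τ + -1 / τ / 2 by ring,
      show -(z + τ / 2) / τ + 1 = -z / τ + 1 / 2 by field_simp; ring,
      show -(z + τ / 2 + 1 / 2) / τ + 1 = -z / τ + -1 / τ / 2 + 1 / 2 by field_simp; ring]
    ring
  have hE : Complex.exp (Complex.I * Real.pi * B22 z 1 τ) *
      Complex.exp (Complex.I * Real.pi * B22 (z + 1 / 2) 1 τ) *
      (Complex.exp (Complex.I * Real.pi * B22 (z + τ / 2) 1 τ) *
      Complex.exp (Complex.I * Real.pi * B22 (z + τ / 2 + 1 / 2) 1 τ)) =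
      Complex.exp (Complex.I * Real.pi * B22 (2 * z) 1 τ) := by
    rw [← Complex.exp_add, ← Complex.exp_add, ← Complex.exp_add]
    congr 1
    unfold B22
    field_simp
    ring
  have hc0 : c ≠ 0 := by
    rintro rfl
    rw [zero_mul] at p5
    exact mul_ne_zero (hu _ hw) (Complex.exp_ne_zero _) p5
  have hfin : c * theta (-(2 * z) / τ) (-1 / τ) * c ^ 3 = c * theta (-(2 * z) / τ) (-1 / τ) * 1 := by
    calc _ = (c * theta (-z / τ) (-1 / τ)) * (c * theta (-(z + 1 / 2) / τ) (-1 / τ)) *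
        ((c * theta (-(z + τ / 2) / τ) (-1 / τ)) *
          (c * theta (-(z + τ / 2 + 1 / 2) / τ) (-1 / τ))) := by rw [← d2]; ring
      _ = _ := by rw [← p1, ← p2, ← p3, ← p4, mul_one, ← p5, ← d1, ← hE]; ring
  exact mul_left_cancel₀ (mul_ne_zero hc0 (hv _ hw)) hfin

/-- When Im(a/b) > 0, b/a = -(-1/(a/b)), so inverting the base turns the quotient of the modular
relation into a symmetric product. The other sign follows by exchanging a and b. -/
theorem exists_theta_mul_theta {a b : ℂ} (hab : (a / b).im ≠ 0) :
    ∃ c : ℂ, c ^ 3 = 1 ∧ ∀ z ∉ lat a b 0,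
      theta (z / b) (a / b) * theta (z / a) (b / a) *
        Complex.exp (Complex.I * Real.pi * B22 z a b) = c := by
  have main : ∀ a b : ℂ, 0 < (a / b).im → ∃ c : ℂ, c ^ 3 = 1 ∧ ∀ z ∉ lat a b 0,
      theta (z / b) (a / b) * theta (z / a) (b / a) *
        Complex.exp (Complex.I * Real.pi * B22 z a b) = c := by
    intro a b hab
    have hb : b ≠ 0 := by rintro rfl; simp at hab
    have ha : a ≠ 0 := by rintro rfl; simp at hab
    obtain ⟨c, hc3, hc⟩ := exists_theta_modular hab
    refine ⟨c, hc3, fun z hz => ?_⟩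
    have hz' : z / b ∉ lat 1 (a / b) 0 := by
      rintro ⟨l, m, n, h⟩
      refine hz ⟨m, l, 0, ?_⟩
      field_simp at h
      linear_combination h
    have him : (-1 / (a / b)).im ≠ 0 := by
      have : -1 / (a / b) = -(a / b)⁻¹ := by ring
      rw [this, Complex.neg_im, Complex.inv_im, neg_div, neg_neg]
      exact (div_pos hab (Complex.normSq_pos.2 (div_ne_zero ha hb))).ne'
    have h1 : theta (z / a) (b / a) = (theta (-(z / b) / (a / b)) (-1 / (a / b)))⁻¹ := by
      rw [show b / a = -(-1 / (a / b)) by field_simp, theta_neg _ him, ← theta_reflect]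
      congr 2
      field_simp
      ring
    have h2 : B22 z a b = B22 (z / b) 1 (a / b) := by
      unfold B22; field_simp; ring
    rw [← hc _ hz', h1, h2]
    ring
  rcases hab.lt_or_gt with h | h
  · have h' : 0 < (b / a).im := by
      have hba : b / a = (a / b)⁻¹ := by rw [inv_div]
      rw [hba, Complex.inv_im]
      exact div_pos (by linarith) (Complex.normSq_pos.2 fun h0 => by simp [h0] at h)
    obtain ⟨c, hc3, hc⟩ := main b a h'
    refine ⟨c, hc3, fun z hz => ?_⟩
    rw [← hc z fun ⟨l, m, n, h⟩ => hz ⟨m, l, n, by rw [h]; ring⟩, mul_comm (theta (z / b) _)]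
    congr 3
    unfold B22; ring
  · exact main a b h

/-! ### The homogeneous form of the modular relation -/

theorem im_div_ne_zero_symm {a b : ℂ} (h : (a / b).im ≠ 0) : (b / a).im ≠ 0 := by
  rw [← inv_div, Complex.inv_im]
  exact div_ne_zero (neg_ne_zero.2 h) fun h0 => h (by rw [Complex.normSq_eq_zero.1 h0]; simp)

/-- The Bernoulli polynomial `B_{3,3}(z | a, b, c)`. -/
noncomputable def B33 (z a b c : ℂ) : ℂ :=
  (z ^ 3 - 3 / 2 * (a + b + c) * z ^ 2 +
    (a ^ 2 + b ^ 2 + c ^ 2 + 3 * (a * b + b * c + c * a)) / 2 * z -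
    (a + b + c) * (a * b + b * c + c * a) / 4) / (a * b * c)

/-- The homogeneous product of three elliptic gamma functions. -/
noncomputable def tripleGam (z a b c : ℂ) : ℂ :=
  Gam (z / c) (a / c) (b / c) * Gam (z / a) (b / a) (c / a) * Gam (z / b) (c / b) (a / b)

/-- The product of three elliptic gamma functions times the exponential of a cubic polynomial,
which turns out to be identically one. -/
noncomputable def normTripleGam (z a b c : ℂ) : ℂ :=
  tripleGam z a b c * Complex.exp (Complex.I * Real.pi * (B33 z a b c / 3))

theorem normTripleGam_rotate (z a b c : ℂ) : normTripleGam z b c a = normTripleGam z a b c := by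
  unfold normTripleGam tripleGam B33
  congr 1
  · ring
  · ring_nf

theorem div_notMem_lat {a b c z : ℂ} (hc : c ≠ 0) (hz : z ∉ lat a b c) :
    z / c ∉ lat 1 (a / c) (b / c) := by
  rwa [← div_self hc, div_mem_lat_iff hc, lat_rotate b c a, lat_rotate a b c]

/-- B₃₃(z + a|a,b,c) - B₃₃(z|a,b,c) = 3 B₂₂(z|b,c), which is exactly the exponent that the two theta
multipliers need. Cubing removes the remaining root of unity. -/
theorem normTripleGam_add_pow {a b c : ℂ} (hab : (a / b).im ≠ 0) (hbc : (b / c).im ≠ 0)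
    (hca : (c / a).im ≠ 0) : ∀ z ∉ lat a b c,
    normTripleGam (z + a) a b c ^ 3 = normTripleGam z a b c ^ 3 := by
  have hb : b ≠ 0 := by rintro rfl; simp at hab
  have hc : c ≠ 0 := by rintro rfl; simp at hbc
  have ha : a ≠ 0 := by rintro rfl; simp at hab
  obtain ⟨k, hk3, hk⟩ := exists_theta_mul_theta hbc
  intro z hz
  have hz' : z ∉ lat b c 0 := by
    rintro ⟨l, m, n, h⟩
    exact hz ⟨0, l, m, by rw [h]; push_cast; ring⟩
  have h1 := Gam_add_left (im_div_ne_zero_symm hca) hbc (div_notMem_lat hc hz)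
  have h2 := Gam_add_left hab (im_div_ne_zero_symm hbc) (z := z / b) (by
    rw [lat_swap]
    exact div_notMem_lat hb (by rwa [← lat_rotate, lat_rotate, ← lat_rotate]))
  have hF : normTripleGam (z + a) a b c = k * normTripleGam z a b c := by
    rw [← hk z hz', normTripleGam, normTripleGam, tripleGam, tripleGam, add_div, add_div, add_div,
      div_self ha, Gam_add_one, h1, Gam_comm (z / b + a / b), h2, Gam_comm (z / b) (a / b)]
    have hB : Complex.exp (Complex.I * Real.pi * (B33 (z + a) a b c / 3)) =
        Complex.exp (Complex.I * Real.pi * B22 z b c) *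
          Complex.exp (Complex.I * Real.pi * (B33 z a b c / 3)) := by
      rw [← Complex.exp_add]
      congr 1
      unfold B33 B22
      field_simp
      ring
    rw [hB]
    ring
  rw [hF, mul_pow, hk3, one_mul]

theorem exists_isRep_tripleGam {a b c : ℂ} (hab : (a / b).im ≠ 0) (hbc : (b / c).im ≠ 0)
    (hca : (c / a).im ≠ 0) : ∃ N D : ℂ → ℂ, Differentiable ℂ N ∧ Differentiable ℂ D ∧
      (∀ z, normTripleGam z a b c = N z / D z) ∧ (∀ z ∈ hexagon a b c, D z ≠ 0) ∧
      ∀ z ∉ lat a b c, D z ≠ 0 := by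
  have hb : b ≠ 0 := by rintro rfl; simp at hab
  have hc : c ≠ 0 := by rintro rfl; simp at hbc
  have ha : a ≠ 0 := by rintro rfl; simp at hab
  have hdiv : ∀ d : ℂ, Differentiable ℂ fun z => z / d := fun d => differentiable_id.div_const d
  obtain ⟨N₁, D₁, h1⟩ := exists_isRep (im_div_ne_zero_symm hca) hbc
  obtain ⟨N₂, D₂, h2⟩ := exists_isRep (im_div_ne_zero_symm hab) hca
  obtain ⟨N₃, D₃, h3⟩ := exists_isRep (im_div_ne_zero_symm hbc) hab
  have hs : ∀ z x y d : ℂ, 2 * (z / d) - x / d - y / d = (2 * z - x - y) / d := by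
    intro z x y d; ring
  refine ⟨fun z => N₁ (z / c) * N₂ (z / a) * N₃ (z / b) *
      Complex.exp (Complex.I * Real.pi * (B33 z a b c / 3)),
    fun z => D₁ (z / c) * D₂ (z / a) * D₃ (z / b), ?_, ?_, ?_, ?_, ?_⟩
  · refine (((h1.diff_num.comp (hdiv c)).mul (h2.diff_num.comp (hdiv a))).mul
      (h3.diff_num.comp (hdiv b))).mul ?_
    unfold B33
    fun_prop
  · exact ((h1.diff_den.comp (hdiv c)).mul (h2.diff_den.comp (hdiv a))).mul
      (h3.diff_den.comp (hdiv b))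
  · intro z
    rw [normTripleGam, tripleGam, h1.eq_div, h2.eq_div, h3.eq_div]
    ring
  · rintro z ⟨hz1, hz2, hz3⟩
    rw [← hs] at hz1 hz2 hz3
    exact mul_ne_zero (mul_ne_zero (h1.ne_zero_of_strip _ hz1).2 (h2.ne_zero_of_strip _ hz2).2)
      (h3.ne_zero_of_strip _ hz3).2
  · intro z hz
    have hz2 : z ∉ lat b c a := by rwa [lat_rotate]
    have hz3 : z ∉ lat c a b := by rwa [lat_rotate]
    exact mul_ne_zero (mul_ne_zero (h1.ne_zero_of_notMem _ (div_notMem_lat hc hz)).2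
      (h2.ne_zero_of_notMem _ (div_notMem_lat ha hz2)).2)
      (h3.ne_zero_of_notMem _ (div_notMem_lat hb hz3)).2

theorem normTripleGam_eq_one {a b c : ℂ} (hab : (a / b).im ≠ 0) (hbc : (b / c).im ≠ 0)
    (hca : (c / a).im ≠ 0) : ∀ z ∉ lat a b c, normTripleGam z a b c = 1 := by
  have hb : b ≠ 0 := by rintro rfl; simp at hab
  have hc : c ≠ 0 := by rintro rfl; simp at hbc
  have ha : a ≠ 0 := by rintro rfl; simp at hab
  obtain ⟨N, D, hN, hD, hND, hDU, hDL⟩ := exists_isRep_tripleGam hab hbc hca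
  obtain ⟨k, hk, -⟩ : ∃ k, (∀ z ∈ hexagon a b c, normTripleGam z a b c ^ 3 = k) ∧
      ∀ z ∉ lat a b c, normTripleGam z a b c ^ 3 = k := by
    refine exists_const_of_periodic (f := fun z => normTripleGam z a b c ^ 3) hab
      (dense_compl_lat a b c) (add_left_mem_lat_iff a b c) (add_mid_mem_lat_iff a b c)
      (normTripleGam_add_pow hab hbc hca) ?_ (isOpen_hexagon a b c) ?_
      (exists_add_mem_hexagon hab hbc (im_div_ne_zero_symm hca))
    · intro z hz
      have h := normTripleGam_add_pow hbc hca hab z (by rwa [lat_rotate])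
      rwa [normTripleGam_rotate _ a b c, normTripleGam_rotate _ a b c] at h
    · simp only [hND]
      exact fun z hz =>
        ((hN z).differentiableWithinAt.div (hD z).differentiableWithinAt (hDU z hz)).pow 3
  -- The centre of the hexagon, and the fixed point of z ↦ a + b + c - z, under which B₃₃ is odd.
  set z₀ := (a + b + c) / 2 with hz₀
  have hc1 : (2 * z₀ - a - b) / c = 1 := by rw [hz₀]; field_simp; ring
  have ha1 : (2 * z₀ - b - c) / a = 1 := by rw [hz₀]; field_simp; ring
  have hb1 : (2 * z₀ - c - a) / b = 1 := by rw [hz₀]; field_simp; ring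
  have hmem : z₀ ∈ hexagon a b c := by
    refine ⟨?_, ?_, ?_⟩
    · rw [hc1]; simpa using add_pos_of_nonneg_of_pos (abs_nonneg _) (abs_pos.2 hbc)
    · rw [ha1]; simpa using add_pos_of_nonneg_of_pos (abs_nonneg _) (abs_pos.2 hca)
    · rw [hb1]; simpa using add_pos_of_nonneg_of_pos (abs_nonneg _) (abs_pos.2 hab)
  have hone : normTripleGam z₀ a b c = 1 := by
    have hB : B33 z₀ a b c = 0 := by rw [hz₀]; unfold B33; field_simp; ring
    rw [normTripleGam, tripleGam, hB,
      Gam_eq_one (im_div_ne_zero_symm hca) hbc (by rw [← hc1]; ring),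
      Gam_eq_one (im_div_ne_zero_symm hab) hca (by rw [← ha1]; ring),
      Gam_eq_one (im_div_ne_zero_symm hbc) hab (by rw [← hb1]; ring)]
    simp
  have hk1 : k = 1 := by rw [← hk z₀ hmem, hone, one_pow]
  have hcont : ContinuousAt (fun z => normTripleGam z a b c) z₀ := by
    simp only [hND]
    exact (hN z₀).continuousAt.div (hD z₀).continuousAt (hDU z₀ hmem)
  have hev : ∀ᶠ z in nhds z₀, N z = D z := by
    have hq : ContinuousAt (fun z => normTripleGam z a b c ^ 2 + normTripleGam z a b c + 1) z₀ :=
      ((hcont.pow 2).add hcont).add continuousAt_const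
    -- The factor F² + F + 1 of F³ - 1 equals 3 at z₀, so near z₀ the equation F³ = 1 forces F = 1.
    have hq0 : normTripleGam z₀ a b c ^ 2 + normTripleGam z₀ a b c + 1 ≠ 0 := by
      rw [hone]; norm_num
    filter_upwards [hq.eventually_ne hq0, (isOpen_hexagon a b c).mem_nhds hmem] with z hz hzU
    have h3 := hk z hzU
    rw [hk1] at h3
    have h1 : normTripleGam z a b c = 1 := by
      refine sub_eq_zero.1 ((mul_eq_zero.1 ?_).resolve_right hz)
      linear_combination h3
    rw [hND] at h1
    exact (div_eq_one_iff_eq (hDU z hzU)).1 h1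
  have hND' : N = D := AnalyticOnNhd.eq_of_eventuallyEq (fun z _ => hN.analyticAt z)
    (fun z _ => hD.analyticAt z) hev
  intro z hz
  rw [hND, hND', div_self (hDL z hz)]

/-! ### The relations off the lattice -/

/-- The homogeneous relation is used at z + 1: reflecting a parameter shifts the argument by that
parameter, and the shift by 1/σ or 1/τ is absorbed there, while Γ(·, τ, σ) has period 1. -/
theorem Gam_modular_of_notMem {τ σ : ℂ} (hτ : τ.im ≠ 0) (hσ : σ.im ≠ 0)
    (hστ : (σ / τ).im ≠ 0) {z : ℂ} (hz : z ∉ lat 1 τ σ) :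
    Gam (z / σ) (τ / σ) (-1 / σ) = Complex.exp (Complex.I * Real.pi * Q z τ σ) *
      Gam ((z - σ) / τ) (-1 / τ) (-σ / τ) * Gam z τ σ := by
  have hτ0 : τ ≠ 0 := by rintro rfl; simp at hτ
  have hσ0 : σ ≠ 0 := by rintro rfl; simp at hσ
  have h1τ : (1 / τ).im ≠ 0 := im_div_ne_zero_symm (by simpa using hτ)
  have h1σ : (1 / σ).im ≠ 0 := im_div_ne_zero_symm (by simpa using hσ)
  have hτσ : (τ / σ).im ≠ 0 := im_div_ne_zero_symm hστ
  have hz1 : z + 1 ∉ lat 1 τ σ := by rwa [add_left_mem_lat_iff]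
  have h := normTripleGam_eq_one h1τ hτσ (by simpa using hσ) _ hz1
  have g1 : Gam (z / σ) (τ / σ) (-1 / σ) = (Gam ((z + 1) / σ) (1 / σ) (τ / σ))⁻¹ := by
    rw [neg_div, Gam_neg_right _ _ h1σ, Gam_comm, add_div]
  have g2 : Gam ((z - σ) / τ) (-1 / τ) (-σ / τ) = Gam ((z + 1) / τ) (σ / τ) (1 / τ) := by
    rw [neg_div, neg_div, Gam_neg_left _ _ h1τ, Gam_neg_right _ _ hστ, inv_inv, Gam_comm]
    congr 1; ring
  have hQ : Q z τ σ = B33 (z + 1) 1 τ σ / 3 := by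
    unfold Q B33; field_simp; ring
  rw [normTripleGam, tripleGam, div_one, div_one, div_one, Gam_add_one, ← hQ] at h
  rw [g1, g2]
  exact inv_eq_of_mul_eq_one_right (by linear_combination h)

theorem Gam_add_of_im_pos {τ σ : ℂ} (hτ : 0 < τ.im) (hσ : 0 < σ.im) (z : ℂ) :
    Gam z τ σ = Gam z (τ + σ) σ * Gam (z + τ) τ (σ + τ) := by
  have hq := norm_e_lt_one_iff.2 hτ
  have hr := norm_e_lt_one_iff.2 hσ
  have hqr : ‖e (τ + σ)‖ < 1 := norm_e_lt_one_iff.2 (by rw [Complex.add_im]; positivity)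
  have hnum := doubleProd_add hr hq (e (τ + σ - z))
  have hden := doubleProd_add hq hr (e z)
  rw [← e_add, ← e_add] at hnum hden
  rw [add_comm σ τ, Gam_eq, Gam_eq, Gam_eq, symb_of_norm_lt_one _ hq hr,
    symb_of_norm_lt_one _ hq hr, symb_of_norm_lt_one _ hqr hr, symb_of_norm_lt_one _ hqr hr,
    symb_of_norm_lt_one _ hq hqr, symb_of_norm_lt_one _ hq hqr, doubleProd_comm _ (e τ) (e σ),
    hnum, hden, add_comm σ τ, doubleProd_comm _ (e (τ + σ)) (e τ), doubleProd_comm _ (e σ)]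
  ring_nf

theorem notMem_lat_of_forall {a b c a' b' c' z : ℂ} (hz : z ∉ lat a b c)
    (ha : a' ∈ lat a b c) (hb : b' ∈ lat a b c) (hc : c' ∈ lat a b c) : z ∉ lat a' b' c' := by
  rintro ⟨l, m, n, rfl⟩
  obtain ⟨l₁, m₁, n₁, rfl⟩ := ha
  obtain ⟨l₂, m₂, n₂, rfl⟩ := hb
  obtain ⟨l₃, m₃, n₃, rfl⟩ := hc
  exact hz ⟨l * l₁ + m * l₂ + n * l₃, l * m₁ + m * m₂ + n * m₃, l * n₁ + m * n₂ + n * n₃,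
    by push_cast; ring⟩

/-- Negating all variables inverts every gamma value, so Im(τ + σ) > 0 may be assumed. If τ or σ
then has negative imaginary part, the positive case applies to (-τ, τ + σ) at z or to (τ + σ, -σ) at
z - σ, and reflection rearranges the same three factors. -/
theorem Gam_add_of_notMem {τ σ : ℂ} (hτ : τ.im ≠ 0) (hσ : σ.im ≠ 0) (hadd : (τ + σ).im ≠ 0)
    {z : ℂ} (hz : z ∉ lat 1 τ σ) :
    Gam z τ σ = Gam z (τ + σ) σ * Gam (z + τ) τ (σ + τ) := by
  have main : ∀ τ σ : ℂ, τ.im ≠ 0 → σ.im ≠ 0 → 0 < (τ + σ).im → ∀ z ∉ lat 1 τ σ,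
      Gam z τ σ = Gam z (τ + σ) σ * Gam (z + τ) τ (σ + τ) := by
    intro τ σ hτ hσ hadd z hz
    have hone : (1 : ℂ) ∈ lat 1 τ σ := ⟨1, 0, 0, by simp⟩
    have hτm : τ ∈ lat 1 τ σ := ⟨0, 1, 0, by simp⟩
    have hσm : σ ∈ lat 1 τ σ := ⟨0, 0, 1, by simp⟩
    have hτσ : τ + σ ∈ lat 1 τ σ := ⟨0, 1, 1, by simp⟩
    have n1 : Gam z τ σ ≠ 0 := Gam_ne_zero hτ hσ hz
    have n2 : Gam z (τ + σ) σ ≠ 0 :=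
      Gam_ne_zero hadd.ne' hσ (notMem_lat_of_forall hz hone hτσ hσm)
    have n3 : Gam (z + τ) τ (τ + σ) ≠ 0 := Gam_ne_zero hτ hadd.ne'
      (notMem_lat_of_forall (by rwa [add_mid_mem_lat_iff]) hone hτm hτσ)
    rcases hτ.lt_or_gt with h | h
    · have := Gam_add_of_im_pos (τ := -τ) (by simpa using h) hadd z
      rw [Gam_neg_left _ _ hτ, neg_add_cancel_left, Gam_neg_left _ _ hτ,
        add_neg_cancel_comm, neg_add_cancel_right, Gam_comm _ σ] at this
      rw [add_comm σ τ]
      field_simp at this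
      linear_combination this
    rcases hσ.lt_or_gt with h' | h'
    · have := Gam_add_of_im_pos (σ := -σ) hadd (by simpa using h') (z - σ)
      rw [Gam_neg_right _ _ hσ, add_neg_cancel_right, Gam_neg_right _ _ hσ, sub_add_cancel,
        neg_add_cancel_comm_assoc, show z - σ + (τ + σ) = z + τ by ring, Gam_comm (z + τ) (τ + σ)] at this
      rw [add_comm σ τ]
      field_simp at this
      linear_combination this
    · exact Gam_add_of_im_pos h h' z
  rcases hadd.lt_or_gt with h | h
  · have := main (-τ) (-σ) (by simpa using hτ) (by simpa using hσ)
      (by simp only [Complex.add_im, Complex.neg_im] at h ⊢; linarith) (-z)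
      (by rwa [lat_neg, lat_swap, lat_neg, lat_swap, neg_mem_lat_iff])
    rw [← neg_add, ← neg_add, ← neg_add, Gam_neg_neg _ hτ hσ, Gam_neg_neg _ hadd hσ,
      Gam_neg_neg _ hτ (by rwa [add_comm]), ← mul_inv] at this
    exact inv_injective this
  · exact main τ σ hτ hσ h z hz

/-! ### From generic points to meromorphic functions and to values -/

theorem meromorphic_Gam_comp {τ σ : ℂ} (hτ : τ.im ≠ 0) (hσ : σ.im ≠ 0) {g : ℂ → ℂ}
    (hg : Differentiable ℂ g) : Meromorphic fun z => Gam (g z) τ σ := by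
  obtain ⟨N, D, h⟩ := exists_isRep hτ hσ
  intro z
  simp only [h.eq_div]
  exact ((h.diff_num.comp hg).analyticAt z).meromorphicAt.div
    ((h.diff_den.comp hg).analyticAt z).meromorphicAt

theorem frequently_punctured_notMem {S : Set ℂ} (hS : S.Countable) (x : ℂ) :
    ∃ᶠ z in nhdsWithin x {x}ᶜ, z ∉ S := by
  have hd : Dense (S ∪ {x})ᶜ := (hS.union (Set.countable_singleton x)).dense_compl ℂ
  rw [frequently_nhdsWithin_iff]
  refine (mem_closure_iff_frequently.1 (hd x)).mono fun z hz => ?_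
  rw [Set.compl_union] at hz
  exact hz

/-- Near each point a meromorphic difference is identically zero or nowhere zero on a punctured
neighbourhood; the second is impossible, as such a neighbourhood contains points outside the
countable set S. -/
theorem eventuallyEq_codiscrete {f g : ℂ → ℂ} (hf : Meromorphic f) (hg : Meromorphic g)
    {S : Set ℂ} (hS : S.Countable) (h : ∀ z ∉ S, f z = g z) : f =ᶠ[codiscrete ℂ] g := by
  rw [EventuallyEq, Filter.Eventually, mem_codiscrete]
  intro x
  rw [disjoint_principal_right, compl_compl]
  rcases ((hf x).sub (hg x)).eventually_eq_zero_or_eventually_ne_zero with h0 | h0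
  · filter_upwards [h0] with z hz using sub_eq_zero.1 hz
  · obtain ⟨z, hz, hz'⟩ := ((frequently_punctured_notMem hS x).and_eventually h0).exists
    exact absurd (sub_eq_zero.2 (h z hz)) hz'

/-- Without a pole Γ has a finite limit c at z, so N = cD there; a zero of D would be a common zero.
-/
theorem IsRep.den_ne_zero_of_not_isPole {τ σ : ℂ} {N D : ℂ → ℂ} (h : IsRep τ σ N D)
    (hτ : τ.im ≠ 0) (hσ : σ.im ≠ 0) {z : ℂ} (hz : ¬ IsPole z τ σ) : D z ≠ 0 := by
  intro hD
  obtain ⟨c, hc⟩ := tendsto_nhds_of_meromorphicOrderAt_nonneg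
    (meromorphic_Gam_comp hτ hσ differentiable_id z) (not_lt.1 hz)
  have h1 : Tendsto (fun w => Gam w τ σ * D w) (nhdsWithin z {z}ᶜ) (nhds (c * D z)) :=
    hc.mul ((h.diff_den z).continuousAt.tendsto.mono_left nhdsWithin_le_nhds)
  have h2 : Tendsto N (nhdsWithin z {z}ᶜ) (nhds (N z)) :=
    (h.diff_num z).continuousAt.tendsto.mono_left nhdsWithin_le_nhds
  have h3 : N z = c * D z := by
    refine tendsto_nhds_unique_of_frequently_eq h2 h1
      ((frequently_punctured_notMem (countable_lat 1 τ σ) z).mono fun w hw => ?_)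
    rw [h.eq_div, div_mul_cancel₀ _ (h.ne_zero_of_notMem w hw).2]
  rcases h.num_or_den_ne_zero z with h4 | h4
  · exact h4 (by rw [h3, hD, mul_zero])
  · exact h4 hD

theorem continuousAt_Gam {τ σ z : ℂ} (hτ : τ.im ≠ 0) (hσ : σ.im ≠ 0) (hz : ¬ IsPole z τ σ) :
    ContinuousAt (fun w => Gam w τ σ) z := by
  obtain ⟨N, D, h⟩ := exists_isRep hτ hσ
  simp only [h.eq_div]
  exact (h.diff_num z).continuousAt.div (h.diff_den z).continuousAt
    (h.den_ne_zero_of_not_isPole hτ hσ hz)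

/-- The relation N = f · D, taken along g, extends to z by continuity. Since N and D have no common
zero, D cannot vanish at g z, so no hypothesis on the poles of the left-hand side is needed. -/
theorem Gam_comp_eq_of_continuousAt {τ σ : ℂ} (hτ : τ.im ≠ 0) (hσ : σ.im ≠ 0) {g f : ℂ → ℂ}
    (hg : Differentiable ℂ g) {S : Set ℂ} (hS : S.Countable) (hSg : ∀ z ∉ S, g z ∉ lat 1 τ σ)
    (h : ∀ z ∉ S, Gam (g z) τ σ = f z) {z : ℂ} (hf : ContinuousAt f z) : Gam (g z) τ σ = f z := by
  obtain ⟨N, D, hr⟩ := exists_isRep hτ hσ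
  have h3 : N (g z) = f z * D (g z) := by
    refine tendsto_nhds_unique_of_frequently_eq
      ((hr.diff_num.comp hg) z).continuousAt.tendsto
      (hf.tendsto.mul ((hr.diff_den.comp hg) z).continuousAt.tendsto)
      ((mem_closure_iff_frequently.1 (hS.dense_compl ℂ z)).mono fun w hw => ?_)
    rw [← h w hw, hr.eq_div]
    exact (div_mul_cancel₀ _ (hr.ne_zero_of_notMem _ (hSg w hw)).2).symm
  have hD : D (g z) ≠ 0 := by
    intro hD
    rcases hr.num_or_den_ne_zero (g z) with h4 | h4
    · exact h4 (by rw [h3, hD, mul_zero])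
    · exact h4 hD
  rw [hr.eq_div, h3, mul_div_cancel_right₀ _ hD]

theorem Q_comm (z τ σ : ℂ) : Q z σ τ = Q z τ σ := by
  unfold Q; ring

theorem Gam_modular {τ σ : ℂ} (hτ : τ.im ≠ 0) (hσ : σ.im ≠ 0) (hστ : (σ / τ).im ≠ 0) :
    MeroEq (fun z => Gam (z / σ) (τ / σ) (-1 / σ))
      (fun z => Complex.exp (Complex.I * Real.pi * Q z τ σ) *
        Gam ((z - σ) / τ) (-1 / τ) (-σ / τ) * Gam z τ σ) ∧
    ∀ z : ℂ, ¬ IsPole ((z - σ) / τ) (-1 / τ) (-σ / τ) → ¬ IsPole z τ σ →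
      Gam (z / σ) (τ / σ) (-1 / σ) = Complex.exp (Complex.I * Real.pi * Q z τ σ) *
        Gam ((z - σ) / τ) (-1 / τ) (-σ / τ) * Gam z τ σ := by
  have hσ0 : σ ≠ 0 := by rintro rfl; simp at hσ
  have h1τ : (-1 / τ).im ≠ 0 := by
    rw [neg_div, Complex.neg_im]
    exact neg_ne_zero.2 (im_div_ne_zero_symm (by simpa using hτ))
  have h1σ : (-1 / σ).im ≠ 0 := by
    rw [neg_div, Complex.neg_im]
    exact neg_ne_zero.2 (im_div_ne_zero_symm (by simpa using hσ))
  have hστ' : (-σ / τ).im ≠ 0 := by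
    rw [neg_div, Complex.neg_im]
    exact neg_ne_zero.2 hστ
  have hτσ : (τ / σ).im ≠ 0 := im_div_ne_zero_symm hστ
  have hdiv : ∀ s d : ℂ, Differentiable ℂ fun z : ℂ => (z - s) / d := fun s d => by fun_prop
  have hQ : Differentiable ℂ fun z => Complex.exp (Complex.I * Real.pi * Q z τ σ) := by
    unfold Q; fun_prop
  have hS := countable_lat 1 τ σ
  have heq : ∀ z ∉ lat 1 τ σ, Gam (z / σ) (τ / σ) (-1 / σ) =
      Complex.exp (Complex.I * Real.pi * Q z τ σ) *
        Gam ((z - σ) / τ) (-1 / τ) (-σ / τ) * Gam z τ σ :=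
    fun z hz => Gam_modular_of_notMem hτ hσ hστ hz
  have hml : Meromorphic fun z => Gam (z / σ) (τ / σ) (-1 / σ) :=
    meromorphic_Gam_comp hτσ h1σ (differentiable_id.div_const σ)
  have hmr : Meromorphic fun z => Complex.exp (Complex.I * Real.pi * Q z τ σ) *
      Gam ((z - σ) / τ) (-1 / τ) (-σ / τ) * Gam z τ σ := fun z =>
    ((hQ.analyticAt z).meromorphicAt.mul (meromorphic_Gam_comp h1τ hστ' (hdiv σ τ) z)).mul
      (meromorphic_Gam_comp hτ hσ differentiable_id z)
  refine ⟨⟨hml, hmr, eventuallyEq_codiscrete hml hmr hS heq⟩, fun z h1 h2 => ?_⟩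
  refine Gam_comp_eq_of_continuousAt hτσ h1σ (g := fun z => z / σ)
    (f := fun z => Complex.exp (Complex.I * Real.pi * Q z τ σ) *
      Gam ((z - σ) / τ) (-1 / τ) (-σ / τ) * Gam z τ σ)
    (differentiable_id.div_const σ) hS (fun w hw hmem => ?_) heq ?_
  · refine div_notMem_lat hσ0 hw ?_
    rwa [neg_div, lat_swap, lat_neg] at hmem
  · exact ((hQ z).continuousAt.mul (ContinuousAt.comp (f := fun z => (z - σ) / τ)
      (continuousAt_Gam h1τ hστ' h1) (hdiv σ τ z).continuousAt)).mul (continuousAt_Gam hτ hσ h2)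

theorem Gam_additive {τ σ : ℂ} (hτ : τ.im ≠ 0) (hσ : σ.im ≠ 0) (hadd : (τ + σ).im ≠ 0) :
    MeroEq (fun z => Gam z (τ + σ) σ) (fun z => Gam z τ σ / Gam (z + τ) τ (σ + τ)) ∧
    ∀ z : ℂ, ¬ IsPole z τ σ → ¬ IsPole (z + τ) τ (σ + τ) → Gam (z + τ) τ (σ + τ) ≠ 0 →
      Gam z (τ + σ) σ = Gam z τ σ / Gam (z + τ) τ (σ + τ) := by
  have hadd' : (σ + τ).im ≠ 0 := by rwa [add_comm]
  have hS := countable_lat 1 τ σ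
  have heq : ∀ z ∉ lat 1 τ σ, Gam z (τ + σ) σ = Gam z τ σ / Gam (z + τ) τ (σ + τ) := by
    intro z hz
    have h := Gam_add_of_notMem hτ hσ hadd hz
    have h0 := Gam_ne_zero hτ hσ hz
    rw [h] at h0
    rw [h, mul_div_cancel_right₀ _ (right_ne_zero_of_mul h0)]
  have hshift : Differentiable ℂ fun z => z + τ := differentiable_id.add_const τ
  have hml : Meromorphic fun z => Gam z (τ + σ) σ :=
    meromorphic_Gam_comp hadd hσ differentiable_id
  have hmr : Meromorphic fun z => Gam z τ σ / Gam (z + τ) τ (σ + τ) := fun z =>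
    (meromorphic_Gam_comp hτ hσ differentiable_id z).div (meromorphic_Gam_comp hτ hadd' hshift z)
  refine ⟨⟨hml, hmr, eventuallyEq_codiscrete hml hmr hS heq⟩, fun z h1 h2 h3 => ?_⟩
  refine Gam_comp_eq_of_continuousAt hadd hσ (g := fun z => z)
    (f := fun z => Gam z τ σ / Gam (z + τ) τ (σ + τ)) differentiable_id hS (fun w hw => ?_) heq ?_
  · exact notMem_lat_of_forall hw ⟨1, 0, 0, by simp⟩ ⟨0, 1, 1, by simp⟩ ⟨0, 0, 1, by simp⟩
  · exact (continuousAt_Gam hτ hσ h1).div (ContinuousAt.comp (f := fun z => z + τ)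
      (continuousAt_Gam hτ hadd' h2) (hshift z).continuousAt) h3

theorem IsPole_comm (z τ σ : ℂ) : IsPole z τ σ ↔ IsPole z σ τ := by
  simp only [IsPole, Gam_comm _ τ σ]

end EllipticGamma

theorem mainTheorem1 (τ σ : ℂ) (hτ : τ.im ≠ 0) (hσ : σ.im ≠ 0)
    (hστ : (σ / τ).im ≠ 0) (hadd : (τ + σ).im ≠ 0) :
    -- periodicity in the parameters, at every point `z`
    (∀ z : ℂ, EllipticGamma.Gam z (τ + 1) σ = EllipticGamma.Gam z τ σ ∧
      EllipticGamma.Gam z τ (σ + 1) = EllipticGamma.Gam z τ σ) ∧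
    -- the three-term relations, as identities between meromorphic functions of `z`
    EllipticGamma.MeroEq
      (fun z => EllipticGamma.Gam z (τ + σ) σ)
      (fun z => EllipticGamma.Gam z τ σ / EllipticGamma.Gam (z + τ) τ (σ + τ)) ∧
    EllipticGamma.MeroEq
      (fun z => EllipticGamma.Gam (z / σ) (τ / σ) (-1 / σ))
      (fun z => Complex.exp (Complex.I * Real.pi * EllipticGamma.Q z τ σ) *
        EllipticGamma.Gam ((z - σ) / τ) (-1 / τ) (-σ / τ) * EllipticGamma.Gam z τ σ) ∧
    EllipticGamma.MeroEq
      (fun z => EllipticGamma.Gam (z / τ) (-1 / τ) (σ / τ))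
      (fun z => Complex.exp (Complex.I * Real.pi * EllipticGamma.Q z τ σ) *
        EllipticGamma.Gam ((z - τ) / σ) (-τ / σ) (-1 / σ) * EllipticGamma.Gam z τ σ) ∧
    -- the same relations between values, at every point where the right-hand side is defined
    (∀ z : ℂ, ¬ EllipticGamma.IsPole z τ σ → ¬ EllipticGamma.IsPole (z + τ) τ (σ + τ) →
      EllipticGamma.Gam (z + τ) τ (σ + τ) ≠ 0 →
      EllipticGamma.Gam z (τ + σ) σ =
        EllipticGamma.Gam z τ σ / EllipticGamma.Gam (z + τ) τ (σ + τ)) ∧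
    (∀ z : ℂ, ¬ EllipticGamma.IsPole ((z - σ) / τ) (-1 / τ) (-σ / τ) →
      ¬ EllipticGamma.IsPole z τ σ →
      EllipticGamma.Gam (z / σ) (τ / σ) (-1 / σ) =
        Complex.exp (Complex.I * Real.pi * EllipticGamma.Q z τ σ) *
          EllipticGamma.Gam ((z - σ) / τ) (-1 / τ) (-σ / τ) * EllipticGamma.Gam z τ σ) ∧
    (∀ z : ℂ, ¬ EllipticGamma.IsPole ((z - τ) / σ) (-τ / σ) (-1 / σ) →
      ¬ EllipticGamma.IsPole z τ σ →
      EllipticGamma.Gam (z / τ) (-1 / τ) (σ / τ) =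
        Complex.exp (Complex.I * Real.pi * EllipticGamma.Q z τ σ) *
          EllipticGamma.Gam ((z - τ) / σ) (-τ / σ) (-1 / σ) * EllipticGamma.Gam z τ σ) := by
  have h2 := EllipticGamma.Gam_additive hτ hσ hadd
  have h3 := EllipticGamma.Gam_modular hτ hσ hστ
  have h4 := EllipticGamma.Gam_modular hσ hτ (EllipticGamma.im_div_ne_zero_symm hστ)
  simp only [EllipticGamma.Q_comm, EllipticGamma.Gam_comm _ (σ / τ),
    EllipticGamma.Gam_comm _ (-1 / σ), EllipticGamma.Gam_comm _ σ τ,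
    EllipticGamma.IsPole_comm _ (-1 / σ), EllipticGamma.IsPole_comm _ σ τ] at h4
  exact ⟨fun z => ⟨EllipticGamma.Gam_add_one_left z τ σ, EllipticGamma.Gam_add_one_right z τ σ⟩,
    h2.1, h3.1, h4.1, h2.2, h3.2, h4.2⟩
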